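/- Let $B_k$ denote the Bernoulli numbers, $\varphi$ Euler's totient function, and $|\cdot|_p$ the $p$-adic absolute value with $|p|_p=p^{-1}$; $p$ always denotes a prime. For $r\ge 1$ let $\Psi_r$ be the set of irregular pairs of order $r$, i.e. of pairs $(p,l)$ with $p$ prime, $l$ even, $2\le l<\varphi(p^r)$ and $p^r\mid B_l/l$ (divisibility of $p$-integers). For $(p,l)\in\Psi_1$ let $\Delta_{(p,l)}\in\{0,\dots,p-1\}$ be the residue modulo $p$ of $$p^{-1}\left(\frac{B_{l+p-1}}{l+p-1}-\frac{B_l}{l}\right).$$ The pair $(p,l)$ is called singular if $\Delta_{(p,l)}=0$ and nonsingular otherwise. If $(p,l)\in\Psi_1$ is nonsingular, there is a unique sequence of integers $(s_\nu)_{\nu\ge1}$ with $s_1=l$, $0\le s_\nu<p$ and $\bigl(p,\sum_{\nu=1}^{r}s_\nu\varphi(p^{\nu-1})\bigr)\in\Psi_r$ for all $r\ge1$; put $\chi_{(p,l)}=\sum_{\nu\ge0}s_{\nu+2}\,p^\nu\in\mathbb Z_p$. If $(p,l)\in\Psi_1$ is singular, let $T^0_{(p,l)}$ be the following rooted tree,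 whose nodes carry pairs. The root has height $0$ and carries $(p,l)$. A node of height $r$ carrying $(p,m)$ has children if and only if $(p,m)\in\Psi_{r+2}$, and in that case it has exactly $p$ children, which have height $r+1$ and carry $(p,m+j\varphi(p^{r+1}))$, $j=0,\dots,p-1$. (The same pair may occur at different heights.) The tree is trivial if it consists of its root only. For an even integer $n\geq 2$ with $n\equiv l\pmod{p-1}$ let $$h_0(p,n)=\max\{\nu-1:\ \nu\ge1,\ T^0_{(p,l)}\text{ has a node of height }\nu-1\text{ carrying }(p,\,n\bmod\varphi(p^\nu))\}.$$ **Theorem.** Let $n\ge2$ be even. There are only finitely many $(p,l)\in\Psi_1$ with $n\equiv l\pmod{p-1}$; for the nonsingular ones the sequence $(s_\nu)$ exists and is unique, and for the singular ones the maximum defining $h_0(p,n)$ exists. Moreover $$B_n=(-1)^{\frac n2-1}\prod_{p-1\nmid n}|n|_p^{-1}\ \prod_{\substack{(p,l)\in\Psi_1,\ \Delta_{(p,l)}\ne0\\ n\equiv l\ (\mathrm{mod}\ p-1)}}\left|p\left(\chi_{(p,l)}-\tfrac{n-l}{p-1}\right)\right|_p^{-1}\ \prod_{\substack{(p,l)\in\Psi_1,\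 \Delta_{(p,l)}=0\\ n\equiv l\ (\mathrm{mod}\ p-1)}}p^{1+h_0(p,n)}\ \prod_{p-1\mid n}p^{-1}.$$ Furthermore, for every singular $(p,l)\in\Psi_1$ with $n\equiv l\pmod{p-1}$, one has $h_0(p,n)=0$ if and only if the tree $T^0_{(p,l)}$ is trivial; otherwise $h_0(p,n)\ge1$. -/

import Mathlib

/-- `Ψ_r^irr`: the set of irregular pairs `(p, l)` of order `r` (for `r ≥ 1`), i.e. `p` is prime,
`2 ≤ l < φ(p^r)`, `l` is even and `p^r` divides `B_l / l` (as a `p`-integer; since `r ≥ 1`, this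
says that `p^r` divides the numerator of the reduced fraction `B_l / l`). -/
def irregularPairs (r : ℕ) : Set (Nat.Primes × ℕ) :=
  {x | 2 ≤ x.2 ∧ x.2 < Nat.totient ((x.1 : ℕ) ^ r) ∧ Even x.2 ∧
    ((x.1 : ℕ) : ℤ) ^ r ∣ (bernoulli x.2 / (x.2 : ℚ)).num}

instance instFactPrimeOfNatPrimes (p : Nat.Primes) : Fact (p : ℕ).Prime := ⟨p.2⟩

/-- The residue `0 ≤ d < p` of a `p`-integral rational number `q` modulo the prime `p`. -/
def ratResidue (p : ℕ) (q : ℚ) : ℕ :=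
  ((q.num : ZMod p) * (q.den : ZMod p)⁻¹).val

/-- `Δ_(p,l)` for an irregular pair `(p, l)` of order `r`: the residue modulo `p` in `[0, p)` of
`p^{-r} (B_{l+φ(p^r)}/(l+φ(p^r)) - B_l/l)`, which is a `p`-integer by the Kummer congruences.
The pair is singular if this residue is `0`. -/
def irrDelta (r p l : ℕ) : ℕ :=
  ratResidue p
    ((bernoulli (l + Nat.totient (p ^ r)) / ((l + Nat.totient (p ^ r) : ℕ) : ℚ)
      - bernoulli l / (l : ℚ)) / (p : ℚ) ^ r)

/-- `s 0, s 1, s 2, …` are the digits `s_1, s_2, s_3, …` of a sequence of irregular pairs of all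
orders `r ≥ 1` above `(p, l)`: `s_1 = l`, `0 ≤ s_ν < p`, and
`(p, ∑_{ν=1}^{r} s_ν φ(p^{ν-1}))` is an irregular pair of order `r`. -/
def IsIrrDigits (p : Nat.Primes) (l : ℕ) (s : ℕ → ℕ) : Prop :=
  s 0 = l ∧ (∀ i, s i < (p : ℕ)) ∧
    ∀ r, 1 ≤ r →
      (p, ∑ i ∈ Finset.range r, s i * Nat.totient ((p : ℕ) ^ i)) ∈ irregularPairs r

open Classical in
/-- The characteristic `p`-adic integer `χ_(p,l) = ∑_{ν ≥ 0} s_{ν+2} p^ν` of a nonsingular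
irregular pair, where `(s_ν)_{ν ≥ 1}` is its digit sequence
(with the value `0` if there is no such sequence). -/
noncomputable def irrChi (p : Nat.Primes) (l : ℕ) : ℤ_[(p : ℕ)] :=
  if h : ∃ s, IsIrrDigits p l s then
    ∑' i : ℕ, ((h.choose (i + 1) : ℕ) : ℤ_[(p : ℕ)]) * ((p : ℕ) : ℤ_[(p : ℕ)]) ^ i
  else 0

/-- `IrrNode p l r m`: the rooted `p`-ary tree `T⁰_(p,l)` has a node of height `r` that carries
the pair `(p, m)`. The root has height `0` and carries `(p, l)`. A node of height `r` carrying
`(p, m)` (a pair of order `r + 1`) has children exactly if `(p, m)` is also an irregular pair of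
order `r + 2`, and then it has the `p` children `(p, m + j φ(p^(r+1)))`, `0 ≤ j < p`. -/
inductive IrrNode (p : Nat.Primes) (l : ℕ) : ℕ → ℕ → Prop
  | root : IrrNode p l 0 l
  | child (r m j : ℕ) : IrrNode p l r m → (p, m) ∈ irregularPairs (r + 2) → j < (p : ℕ) →
      IrrNode p l (r + 1) (m + j * Nat.totient ((p : ℕ) ^ (r + 1)))

/-- The tree `T⁰_(p,l)` as the set of its nodes; a node is recorded as (height, index), because
the same pair may sit at nodes of different heights. -/
def irrTree (p : Nat.Primes) (l : ℕ) : Set (ℕ × ℕ) :=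
  {x | IrrNode p l x.1 x.2}

/-- The tree consists of its root only. -/
def IrrTreeTrivial (p : Nat.Primes) (l : ℕ) : Prop :=
  irrTree p l = {(0, l)}

/-- The heights `r = ν - 1` (`ν ≥ 1`) at which the tree `T⁰_(p,l)`, with `l = n mod (p - 1)`,
has the node `(p, n mod φ(p^ν))`. -/
def irrHeights (p : Nat.Primes) (n : ℕ) : Set ℕ :=
  {r | (r, n % Nat.totient ((p : ℕ) ^ (r + 1))) ∈ irrTree p (n % ((p : ℕ) - 1))}

/-- The height `h₀(p,n)`, the maximum of `irrHeights p n`. -/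
noncomputable def irrHeight (p : Nat.Primes) (n : ℕ) : ℕ :=
  sSup (irrHeights p n)

/-- The nonsingular irregular pairs `(p, l)` (of order one) with `n ≡ l mod (p - 1)`. -/
def nonsingularPairs (n : ℕ) : Set (Nat.Primes × ℕ) :=
  {x | x ∈ irregularPairs 1 ∧ irrDelta 1 x.1 x.2 ≠ 0 ∧ n ≡ x.2 [MOD (x.1 : ℕ) - 1]}

/-- The singular irregular pairs `(p, l)` (of order one) with `n ≡ l mod (p - 1)`. -/
def singularPairs (n : ℕ) : Set (Nat.Primes × ℕ) :=
  {x | x ∈ irregularPairs 1 ∧ irrDelta 1 x.1 x.2 = 0 ∧ n ≡ x.2 [MOD (x.1 : ℕ) - 1]}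

/-! ### Binomial estimates in `ℚ_[p]` -/

section PadicNorm

variable {p : ℕ} [hp : Fact p.Prime]

/-! Since `B_n` is nonzero for even `n ≥ 2`, the product formula gives `|B_n| = ∏ |B_n|_p⁻¹`, and
the sign is read off from `ζ(n) > 0`. It remains to compute each `|B_n|_p`. If `p - 1 ∣ n`, von
Staudt–Clausen gives `|B_n|_p = p`.

Otherwise write `n = l + (p - 1)s` with `l = n mod (p - 1)`, and set `F(s) = (1 - p^(n-1)) B_n / n`.
The Euler factor is a `p`-adic unit, so `|B_n|_p = |n|_p |F(s)|_p`. Everything rests on a strong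
Kummer congruence (`isKummerFunction_kummerBernoulli`): `F` is `p`-integral, `A = F(1) - F(0)` is
divisible by `p`, and `F(s) - F(t) ≡ (s - t)A` modulo `p²(s - t)`. To prove it, pick a primitive
root `c` modulo `p`. Voronoi's congruence exhibits `(c^n - 1)F(s)` as a limit of integral
combinations of powers `u^(n-1)` with `p ∤ u`. For one such power the congruence follows from the
binomial theorem; it survives integral combinations, limits and division by the units `c^n - 1`.

Three cases follow. (1) `(p, l)` is regular: `F(s) ≡ F(0)` modulo `p`, so `F(s)` is a unit. (2) `Δ ≠
0`, that is `|A| = |p|`: then `|F(s) - F(t)| = |p(s - t)|`. A Hensel-type digit construction finds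
the unique zero `χ` of `F` in `ℤ_p`, and the limit `t → χ` gives `|F(s)| = |p(χ - s)|`. (3) `Δ = 0`,
that is `p² ∣ A`: then `F(s)` modulo `p^(r+2)` depends only on `s` modulo `p^r`. Hence the nodes of
height `r` correspond exactly to the residues `s` modulo `p^r` with `F(s) ≡ 0` modulo `p^(r+1)`, and
`1 + h₀` is the valuation of `F(s)`. -/

theorem Padic.norm_add_le_of_le {x y : ℚ_[p]} {r : ℝ} (hx : ‖x‖ ≤ r) (hy : ‖y‖ ≤ r) : ‖x + y‖ ≤ r :=
  (Padic.nonarchimedean x y).trans (max_le hx hy)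

theorem Padic.norm_sub_le_of_le {x y : ℚ_[p]} {r : ℝ} (hx : ‖x‖ ≤ r) (hy : ‖y‖ ≤ r) : ‖x - y‖ ≤ r := by
  rw [sub_eq_add_neg]
  exact Padic.norm_add_le_of_le hx (by rwa [norm_neg])

theorem Padic.norm_natCast_sub_le_one (s t : ℕ) : ‖(s : ℚ_[p]) - t‖ ≤ 1 := by
  exact_mod_cast Padic.norm_int_le_one (p := p) ((s : ℤ) - t)

theorem Padic.norm_natCast_le_one (s : ℕ) : ‖(s : ℚ_[p])‖ ≤ 1 := by
  exact_mod_cast Padic.norm_int_le_one (p := p) (s : ℤ)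

theorem Padic.norm_p_le_one : ‖(p : ℚ_[p])‖ ≤ 1 := Padic.norm_natCast_le_one p

/-- Says `v_p(m + 2) ≤ m`, which absorbs the denominators of the binomial expansion below. It fails
for `p = 2`, `m = 0`. -/
theorem Padic.norm_p_pow_le_norm_natCast (hp2 : p ≠ 2) (m : ℕ) :
    ‖(p : ℚ_[p])‖ ^ m ≤ ‖((m + 2 : ℕ) : ℚ_[p])‖ := by
  have hp3 : 3 ≤ p := by
    have := hp.out.two_le
    omega
  have hne : ((m + 2 : ℕ) : ℚ_[p]) ≠ 0 := by exact_mod_cast (by omega : m + 2 ≠ 0)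
  rw [Padic.norm_eq_zpow_neg_valuation hne, Padic.valuation_natCast, Padic.norm_p, inv_pow,
    zpow_neg, zpow_natCast]
  have h1 : padicValNat p (m + 2) ≤ m := by
    by_contra! h
    have h2 : p ^ (m + 1) ∣ m + 2 := (pow_dvd_pow p h).trans pow_padicValNat_dvd
    have h3 : p ^ (m + 1) ≤ m + 2 := Nat.le_of_dvd (by omega) h2
    have h4 : ∀ k, k + 2 < 3 ^ (k + 1) := by
      intro k
      induction k with
      | zero => norm_num
      | succ k ih => rw [pow_succ]; omega
    have h5 : 3 ^ (m + 1) ≤ p ^ (m + 1) := Nat.pow_le_pow_left hp3 _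
    have := h4 m
    omega
  have hp1 : (1 : ℝ) ≤ p := by exact_mod_cast hp.out.one_le
  gcongr

/-- From `k C(d, k) = d C(d-1, k-1)`, the term `C(d, k) y^k` is divisible by `d p^k / k`, and for `k
= m + 2` the quotient `p^m / k` is integral. -/
theorem Padic.norm_one_add_pow_sub_le (hp2 : p ≠ 2) {y : ℚ_[p]} (hy : ‖y‖ ≤ ‖(p : ℚ_[p])‖) (d : ℕ) :
    ‖(1 + y) ^ d - 1 - d * y‖ ≤ ‖(p : ℚ_[p]) ^ 2 * d‖ := by
  rcases d with _ | d
  · simp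
  have h : (1 + y) ^ (d + 1) - 1 - ((d + 1 : ℕ) : ℚ_[p]) * y =
      ∑ m ∈ Finset.range d, y ^ (m + 2) * ((d + 1).choose (m + 2) : ℚ_[p]) := by
    rw [add_comm 1 y, add_pow, Finset.sum_range_succ', Finset.sum_range_succ']
    simp
    ring
  rw [h]
  refine IsUltrametricDist.norm_sum_le_of_forall_le_of_nonneg (norm_nonneg _) fun m _ => ?_
  have h1 : ‖((d + 1).choose (m + 2) : ℚ_[p])‖ * ‖((m + 2 : ℕ) : ℚ_[p])‖ ≤
      ‖((d + 1 : ℕ) : ℚ_[p])‖ := by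
    rw [← norm_mul, ← Nat.cast_mul, ← Nat.add_one_mul_choose_eq, Nat.cast_mul, norm_mul]
    exact mul_le_of_le_one_right (norm_nonneg _) (Padic.norm_natCast_le_one _)
  rw [norm_mul, norm_mul, norm_pow, norm_pow]
  calc ‖y‖ ^ (m + 2) * ‖((d + 1).choose (m + 2) : ℚ_[p])‖
      ≤ ‖(p : ℚ_[p])‖ ^ (m + 2) * ‖((d + 1).choose (m + 2) : ℚ_[p])‖ := by gcongr
    _ = ‖(p : ℚ_[p])‖ ^ 2 * (‖((d + 1).choose (m + 2) : ℚ_[p])‖ * ‖(p : ℚ_[p])‖ ^ m) := by ring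
    _ ≤ ‖(p : ℚ_[p])‖ ^ 2 *
        (‖((d + 1).choose (m + 2) : ℚ_[p])‖ * ‖((m + 2 : ℕ) : ℚ_[p])‖) := by
      gcongr
      exact Padic.norm_p_pow_le_norm_natCast hp2 m
    _ ≤ ‖(p : ℚ_[p])‖ ^ 2 * ‖((d + 1 : ℕ) : ℚ_[p])‖ := by gcongr

end PadicNorm

/-- A function `F : ℕ → ℚ_[p]` with integral values whose slope `F 1 - F 0` is divisible by `p` and
which is affine with that slope up to errors `p ^ 2 * (s - t)`. -/
structure IsKummerFunction (p : ℕ) [Fact p.Prime] (F : ℕ → ℚ_[p]) : Prop where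
  norm_le_one : ∀ s, ‖F s‖ ≤ 1
  norm_slope_le : ‖F 1 - F 0‖ ≤ ‖(p : ℚ_[p])‖
  norm_sub_sub_le : ∀ s t : ℕ,
    ‖F s - F t - ((s : ℚ_[p]) - t) * (F 1 - F 0)‖ ≤ ‖(p : ℚ_[p]) ^ 2 * ((s : ℚ_[p]) - t)‖

/-! ### Closure properties of Kummer functions -/

namespace IsKummerFunction

variable {p : ℕ} [hp : Fact p.Prime]

/-- Any approximate slope suffices: the case `s = 1`, `t = 0` shows that `A` agrees with `F 1 - F 0`
modulo `p ^ 2`. -/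
theorem of_slope {F : ℕ → ℚ_[p]} (A : ℚ_[p]) (h1 : ∀ s, ‖F s‖ ≤ 1) (hA : ‖A‖ ≤ ‖(p : ℚ_[p])‖)
    (h2 : ∀ s t : ℕ, ‖F s - F t - ((s : ℚ_[p]) - t) * A‖ ≤ ‖(p : ℚ_[p]) ^ 2 * ((s : ℚ_[p]) - t)‖) :
    IsKummerFunction p F := by
  have h3 : ‖F 1 - F 0 - A‖ ≤ ‖(p : ℚ_[p]) ^ 2‖ := by simpa using h2 1 0
  have h4 : ‖(p : ℚ_[p]) ^ 2‖ ≤ ‖(p : ℚ_[p])‖ := by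
    rw [norm_pow]
    exact pow_le_of_le_one (norm_nonneg _) Padic.norm_p_le_one two_ne_zero
  refine ⟨h1, ?_, fun s t => ?_⟩
  · have := Padic.norm_add_le_of_le (h3.trans h4) hA
    rwa [sub_add_cancel] at this
  · have h5 : ‖((s : ℚ_[p]) - t) * (F 1 - F 0 - A)‖ ≤ ‖(p : ℚ_[p]) ^ 2 * ((s : ℚ_[p]) - t)‖ := by
      rw [norm_mul, norm_mul, mul_comm]
      exact mul_le_mul_of_nonneg_right h3 (norm_nonneg _)
    have := Padic.norm_sub_le_of_le (h2 s t) h5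
    convert this using 2
    ring

theorem norm_sub_le {F : ℕ → ℚ_[p]} (hF : IsKummerFunction p F) (s t : ℕ) :
    ‖F s - F t‖ ≤ ‖(p : ℚ_[p]) * ((s : ℚ_[p]) - t)‖ := by
  have h1 : ‖(p : ℚ_[p]) ^ 2 * ((s : ℚ_[p]) - t)‖ ≤ ‖(p : ℚ_[p]) * ((s : ℚ_[p]) - t)‖ := by
    rw [norm_mul, norm_mul, norm_pow]
    exact mul_le_mul_of_nonneg_right
      (pow_le_of_le_one (norm_nonneg _) Padic.norm_p_le_one two_ne_zero) (norm_nonneg _)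
  have h2 : ‖((s : ℚ_[p]) - t) * (F 1 - F 0)‖ ≤ ‖(p : ℚ_[p]) * ((s : ℚ_[p]) - t)‖ := by
    rw [mul_comm, norm_mul, norm_mul]
    exact mul_le_mul_of_nonneg_right hF.norm_slope_le (norm_nonneg _)
  have := Padic.norm_add_le_of_le ((hF.norm_sub_sub_le s t).trans h1) h2
  rwa [sub_add_cancel] at this

theorem norm_sub_le_norm_p {F : ℕ → ℚ_[p]} (hF : IsKummerFunction p F) (s t : ℕ) :
    ‖F s - F t‖ ≤ ‖(p : ℚ_[p])‖ := by
  refine (hF.norm_sub_le s t).trans ?_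
  rw [norm_mul]
  exact mul_le_of_le_one_right (norm_nonneg _) (Padic.norm_natCast_sub_le_one s t)

theorem sum {ι : Type*} (S : Finset ι) (w : ι → ℚ_[p]) (F : ι → ℕ → ℚ_[p])
    (hw : ∀ a ∈ S, ‖w a‖ ≤ 1) (hF : ∀ a ∈ S, IsKummerFunction p (F a)) :
    IsKummerFunction p (fun s => ∑ a ∈ S, w a * F a s) := by
  have key : ∀ (a : ι) (x : ℚ_[p]) (r : ℝ), a ∈ S → ‖x‖ ≤ r → ‖w a * x‖ ≤ r := by
    intro a x r ha hx
    rw [norm_mul]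
    exact (mul_le_of_le_one_left (norm_nonneg _) (hw a ha)).trans hx
  refine ⟨fun s => ?_, ?_, fun s t => ?_⟩
  · exact IsUltrametricDist.norm_sum_le_of_forall_le_of_nonneg zero_le_one
      fun a ha => key a _ _ ha ((hF a ha).norm_le_one s)
  · rw [← Finset.sum_sub_distrib]
    refine IsUltrametricDist.norm_sum_le_of_forall_le_of_nonneg (norm_nonneg _) fun a ha => ?_
    rw [← mul_sub]
    exact key a _ _ ha (hF a ha).norm_slope_le
  · rw [← Finset.sum_sub_distrib, ← Finset.sum_sub_distrib, Finset.mul_sum,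
      ← Finset.sum_sub_distrib]
    refine IsUltrametricDist.norm_sum_le_of_forall_le_of_nonneg (norm_nonneg _) fun a ha => ?_
    have : w a * F a s - w a * F a t - ((s : ℚ_[p]) - t) * (w a * F a 1 - w a * F a 0)
        = w a * (F a s - F a t - ((s : ℚ_[p]) - t) * (F a 1 - F a 0)) := by ring
    rw [this]
    exact key a _ _ ha ((hF a ha).norm_sub_sub_le s t)

theorem sub_const {F : ℕ → ℚ_[p]} (hF : IsKummerFunction p F) {a : ℚ_[p]} (ha : ‖a‖ ≤ 1) :
    IsKummerFunction p (fun s => F s - a) := by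
  refine ⟨fun s => Padic.norm_sub_le_of_le (hF.norm_le_one s) ha, ?_, fun s t => ?_⟩
  · simpa using hF.norm_slope_le
  · simpa using hF.norm_sub_sub_le s t

theorem of_tendsto {F : ℕ → ℕ → ℚ_[p]} {G : ℕ → ℚ_[p]} (hF : ∀ N, IsKummerFunction p (F N))
    (hG : ∀ s, Filter.Tendsto (fun N => F N s) Filter.atTop (nhds (G s))) :
    IsKummerFunction p G :=
  ⟨fun s => le_of_tendsto' (hG s).norm fun N => (hF N).norm_le_one s,
    le_of_tendsto' ((hG 1).sub (hG 0)).norm fun N => (hF N).norm_slope_le,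
    fun s t => le_of_tendsto'
      (((hG s).sub (hG t)).sub (((hG 1).sub (hG 0)).const_mul _)).norm
      fun N => (hF N).norm_sub_sub_le s t⟩

/-- The slope is that of the quotient rule at `0`, namely `(A D(0) - B G(0)) / D(0)²`. Replacing `0`
by `s` or `t` costs only `p²`: the slopes `A`, `B` are divisible by `p`, and `G`, `D` are constant
modulo `p`. -/
theorem div {G D : ℕ → ℚ_[p]} (hG : IsKummerFunction p G) (hD : IsKummerFunction p D)
    (hD1 : ∀ s, ‖D s‖ = 1) : IsKummerFunction p (fun s => G s / D s) := by
  have hne : ∀ s, D s ≠ 0 := fun s => norm_ne_zero_iff.mp (by rw [hD1]; exact one_ne_zero)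
  have hdiv : ∀ s t (x : ℚ_[p]), ‖x / (D s * D t)‖ = ‖x‖ := fun s t x => by simp [hD1]
  have hp2 : ∀ x y : ℚ_[p], ‖x‖ ≤ ‖(p : ℚ_[p])‖ → ‖y‖ ≤ ‖(p : ℚ_[p])‖ →
      ‖x * y‖ ≤ ‖(p : ℚ_[p]) ^ 2‖ := fun x y hx hy => by
    rw [norm_mul, norm_pow, sq]
    exact mul_le_mul hx hy (norm_nonneg _) (norm_nonneg _)
  have hmul : ∀ x y : ℚ_[p], ∀ r : ℝ, ‖x‖ ≤ r → ‖y‖ ≤ 1 → ‖x * y‖ ≤ r := fun x y r hx hy => by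
    rw [norm_mul]
    exact (mul_le_of_le_one_right (norm_nonneg _) hy).trans hx
  set A := G 1 - G 0 with hA
  set B := D 1 - D 0 with hB
  set N := A * D 0 - B * G 0 with hN
  have hNp : ‖N‖ ≤ ‖(p : ℚ_[p])‖ :=
    Padic.norm_sub_le_of_le (hmul _ _ _ hG.norm_slope_le (hD.norm_le_one 0))
      (hmul _ _ _ hD.norm_slope_le (hG.norm_le_one 0))
  refine of_slope (N / (D 0 * D 0)) (fun s => by simp [hD1, hG.norm_le_one]) (by rwa [hdiv])
    fun s t => ?_
  have e1 : ‖N / (D s * D t) - N / (D 0 * D 0)‖ ≤ ‖(p : ℚ_[p]) ^ 2‖ := by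
    have : N / (D s * D t) - N / (D 0 * D 0) =
        N * ((D 0 - D s) * D 0 + (D 0 - D t) * D s) / (D s * D t) / (D 0 * D 0) := by
      field_simp [hne s, hne t, hne 0]
      ring
    rw [this, hdiv, hdiv]
    exact hp2 _ _ hNp (Padic.norm_add_le_of_le
      (hmul _ _ _ (hD.norm_sub_le_norm_p 0 s) (hD.norm_le_one 0))
      (hmul _ _ _ (hD.norm_sub_le_norm_p 0 t) (hD.norm_le_one s)))
  have e2 : ‖A * D t - B * G t - N‖ ≤ ‖(p : ℚ_[p]) ^ 2‖ := by
    have : A * D t - B * G t - N = A * (D t - D 0) - B * (G t - G 0) := by rw [hN]; ring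
    rw [this]
    exact Padic.norm_sub_le_of_le (hp2 _ _ hG.norm_slope_le (hD.norm_sub_le_norm_p t 0))
      (hp2 _ _ hD.norm_slope_le (hG.norm_sub_le_norm_p t 0))
  have e3 : ‖((s : ℚ_[p]) - t) * ((A * D t - B * G t - N) / (D s * D t) +
      (N / (D s * D t) - N / (D 0 * D 0)))‖ ≤ ‖(p : ℚ_[p]) ^ 2 * ((s : ℚ_[p]) - t)‖ := by
    rw [norm_mul, norm_mul, mul_comm]
    refine mul_le_mul_of_nonneg_right (Padic.norm_add_le_of_le ?_ e1) (norm_nonneg _)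
    rwa [hdiv]
  have e4 : ‖((G s - G t - ((s : ℚ_[p]) - t) * A) * D t -
      (D s - D t - ((s : ℚ_[p]) - t) * B) * G t) / (D s * D t)‖ ≤
      ‖(p : ℚ_[p]) ^ 2 * ((s : ℚ_[p]) - t)‖ := by
    rw [hdiv]
    exact Padic.norm_sub_le_of_le (hmul _ _ _ (hG.norm_sub_sub_le s t) (hD.norm_le_one t))
      (hmul _ _ _ (hD.norm_sub_sub_le s t) (hG.norm_le_one t))
  -- Splits the error into the errors of `G` and `D` (`e4`) and the variation of the quotient-rule
  -- slope (`e3`).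
  convert Padic.norm_add_le_of_le e4 e3 using 2
  field_simp [hne s, hne t, hne 0]
  ring

theorem one_add_pow (hp2 : p ≠ 2) {y : ℚ_[p]} (hy : ‖y‖ ≤ ‖(p : ℚ_[p])‖) :
    IsKummerFunction p (fun s => (1 + y) ^ s) := by
  have hle : ∀ s : ℕ, ‖(1 + y) ^ s‖ ≤ 1 := fun s => by
    rw [norm_pow]
    exact pow_le_one₀ (norm_nonneg _) (Padic.norm_add_le_of_le (by simp) (hy.trans Padic.norm_p_le_one))
  have hsub : ∀ s : ℕ, ‖(1 + y) ^ s - 1‖ ≤ ‖(p : ℚ_[p])‖ := fun s => by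
    have h1 : ‖(p : ℚ_[p]) ^ 2 * s‖ ≤ ‖(p : ℚ_[p])‖ := by
      rw [norm_mul, norm_pow, sq, mul_assoc]
      exact mul_le_of_le_one_right (norm_nonneg _)
        (mul_le_one₀ Padic.norm_p_le_one (norm_nonneg _) (Padic.norm_natCast_le_one s))
    have h2 : ‖(s : ℚ_[p]) * y‖ ≤ ‖(p : ℚ_[p])‖ := by
      rw [norm_mul]
      exact (mul_le_of_le_one_left (norm_nonneg _) (Padic.norm_natCast_le_one s)).trans hy
    have := Padic.norm_add_le_of_le ((Padic.norm_one_add_pow_sub_le hp2 hy s).trans h1) h2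
    rwa [sub_add_cancel] at this
  have main : ∀ t d : ℕ, ‖(1 + y) ^ (t + d) - (1 + y) ^ t - ((t + d : ℕ) - (t : ℚ_[p])) * y‖ ≤
      ‖(p : ℚ_[p]) ^ 2 * (((t + d : ℕ) : ℚ_[p]) - t)‖ := fun t d => by
    have hd : ((t + d : ℕ) : ℚ_[p]) - t = d := by push_cast; ring
    have e : (1 + y) ^ (t + d) - (1 + y) ^ t - (d : ℚ_[p]) * y =
        (1 + y) ^ t * ((1 + y) ^ d - 1 - d * y) + ((1 + y) ^ t - 1) * y * d := by ring
    rw [hd, e]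
    refine Padic.norm_add_le_of_le ?_ ?_
    · rw [norm_mul]
      exact (mul_le_of_le_one_left (norm_nonneg _) (hle t)).trans
        (Padic.norm_one_add_pow_sub_le hp2 hy d)
    · rw [norm_mul, norm_mul, norm_mul, norm_pow, sq]
      exact mul_le_mul_of_nonneg_right
        (mul_le_mul (hsub t) hy (norm_nonneg _) (norm_nonneg _)) (norm_nonneg _)
  refine of_slope y hle hy fun s t => ?_
  rcases le_total t s with h | h
  · obtain ⟨d, rfl⟩ := Nat.exists_eq_add_of_le h
    exact main t d
  · obtain ⟨d, rfl⟩ := Nat.exists_eq_add_of_le h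
    have := main s d
    have e1 : (1 + y) ^ s - (1 + y) ^ (s + d) - ((s : ℚ_[p]) - (s + d : ℕ)) * y =
        -((1 + y) ^ (s + d) - (1 + y) ^ s - ((s + d : ℕ) - (s : ℚ_[p])) * y) := by ring
    rwa [e1, norm_neg, norm_mul _ ((s : ℚ_[p]) - _), norm_sub_rev (s : ℚ_[p]), ← norm_mul]

/-- By Fermat `u^(p-1) = 1 + y` with `p ∣ y`, so this is a constant times `(1 + y)^s`. -/
theorem natCast_pow (hp2 : p ≠ 2) {u : ℕ} (hu : ¬ p ∣ u) (m : ℕ) :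
    IsKummerFunction p (fun s => (u : ℚ_[p]) ^ (m + (p - 1) * s)) := by
  have h1 : ‖(u : ℚ_[p]) ^ (p - 1) - 1‖ ≤ ‖(p : ℚ_[p])‖ := by
    have h2 : (p : ℤ) ∣ (u : ℤ) ^ (p - 1) - 1 := by
      rw [← ZMod.intCast_zmod_eq_zero_iff_dvd]
      have : (u : ZMod p) ≠ 0 := by rwa [Ne, ZMod.natCast_eq_zero_iff]
      push_cast
      rw [ZMod.pow_card_sub_one_eq_one this, sub_self]
    have h3 := (Padic.norm_int_le_pow_iff_dvd (p := p) ((u : ℤ) ^ (p - 1) - 1) 1).mpr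
      (by simpa using h2)
    rw [Padic.norm_p]
    simpa using h3
  -- A one-term sum serves as multiplication by the integral constant `u^m`.
  have h2 := sum (Finset.range 1) (fun _ => (u : ℚ_[p]) ^ m) (fun _ s => _)
    (fun _ _ => by
      rw [norm_pow]
      exact pow_le_one₀ (norm_nonneg _) (Padic.norm_natCast_le_one u))
    (fun _ _ => one_add_pow hp2 h1)
  convert h2 using 2 with s
  simp [pow_add, pow_mul]

end IsKummerFunction

/-! ### Bernoulli numbers as `p`-adic limits, and Voronoi's congruence -/

section PowerSums

variable {p : ℕ} [hp : Fact p.Prime]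

open Filter Topology

/-- By Faulhaber's formula the quotient is a fixed polynomial `g` evaluated at `p^N → 0`, and its
constant term is `B_n`. -/
theorem tendsto_sum_range_pow_div (n : ℕ) :
    Tendsto (fun N : ℕ => (∑ a ∈ Finset.range (p ^ N), (a : ℚ_[p]) ^ n) / (p : ℚ_[p]) ^ N) atTop
      (𝓝 ((bernoulli n : ℚ) : ℚ_[p])) := by
  let g : ℚ_[p] → ℚ_[p] := fun x => ∑ i ∈ Finset.range (n + 1),
    ((bernoulli i : ℚ) : ℚ_[p]) * ((n + 1).choose i : ℚ_[p]) * x ^ (n - i) / ((n : ℚ_[p]) + 1)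
  have hg : Continuous g := by fun_prop
  have hn1 : (n : ℚ_[p]) + 1 ≠ 0 := by exact_mod_cast n.succ_ne_zero
  have hp0 : (p : ℚ_[p]) ≠ 0 := by exact_mod_cast hp.out.ne_zero
  have hg0 : g 0 = ((bernoulli n : ℚ) : ℚ_[p]) := by
    simp only [g]
    rw [Finset.sum_range_succ, Finset.sum_eq_zero fun i hi => ?_]
    · simp [Nat.choose_succ_self_right]
      field_simp
    · rw [zero_pow (by have := Finset.mem_range.mp hi; omega)]
      simp
  rw [← hg0]
  have ht : Tendsto (fun N : ℕ => g ((p : ℚ_[p]) ^ N)) atTop (𝓝 (g 0)) :=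
    (hg.tendsto 0).comp (tendsto_pow_atTop_nhds_zero_of_norm_lt_one Padic.norm_p_lt_one)
  refine ht.congr fun N => ?_
  have h := congrArg (fun q : ℚ => (q : ℚ_[p])) (sum_range_pow (p ^ N) n)
  push_cast at h
  rw [h, Finset.sum_div]
  refine Finset.sum_congr rfl fun i hi => ?_
  rw [show n + 1 - i = n - i + 1 by have := Finset.mem_range.mp hi; omega, pow_succ]
  field_simp

theorem sum_range_mul_mod {M : Type*} [AddCommMonoid M] {m c : ℕ} (hm : 0 < m)
    (hc : Nat.Coprime c m) (f : ℕ → M) :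
    ∑ a ∈ Finset.range m, f (c * a % m) = ∑ a ∈ Finset.range m, f a := by
  have hinj : Set.InjOn (fun a => c * a % m) (Finset.range m) := by
    intro a ha b hb hab
    have h1 : c * a ≡ c * b [MOD m] := hab
    have h2 : a ≡ b [MOD m] := Nat.ModEq.cancel_left_of_coprime hc.symm h1
    exact h2.eq_of_lt_of_lt (by simpa using ha) (by simpa using hb)
  have himg : (Finset.range m).image (fun a => c * a % m) = Finset.range m := by
    refine Finset.eq_of_subset_of_card_le (fun x hx => ?_) ?_
    · obtain ⟨a, _, rfl⟩ := Finset.mem_image.mp hx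
      exact Finset.mem_range.mpr (Nat.mod_lt _ hm)
    · rw [Finset.card_image_of_injOn hinj]
  conv_rhs => rw [← himg, Finset.sum_image hinj]

/-- Multiplication by `c` permutes the residues modulo `m`. Expand `(ca mod m)^n = (ca - m⌊ca/m⌋)^n`
to first order in `m` and sum over `a`. -/
theorem sq_dvd_voronoi {m c : ℕ} (hm : 0 < m) (hc : Nat.Coprime c m) (n : ℕ) :
    (m : ℤ) ^ 2 ∣ ((c : ℤ) ^ n - 1) * ∑ a ∈ Finset.range m, (a : ℤ) ^ n -
      n * m * ∑ a ∈ Finset.range m, ((c * a / m : ℕ) : ℤ) * ((c * a : ℕ) : ℤ) ^ (n - 1) := by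
  have h1 : ((c : ℤ) ^ n - 1) * ∑ a ∈ Finset.range m, (a : ℤ) ^ n -
      n * m * ∑ a ∈ Finset.range m, ((c * a / m : ℕ) : ℤ) * ((c * a : ℕ) : ℤ) ^ (n - 1) =
      ∑ a ∈ Finset.range m, (((c * a : ℕ) : ℤ) ^ n - ((c * a % m : ℕ) : ℤ) ^ n -
        n * m * (((c * a / m : ℕ) : ℤ) * ((c * a : ℕ) : ℤ) ^ (n - 1))) := by
    rw [Finset.sum_sub_distrib, Finset.sum_sub_distrib,
      sum_range_mul_mod hm hc (fun a => (a : ℤ) ^ n), ← Finset.mul_sum, sub_mul, one_mul,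
      Finset.mul_sum]
    simp only [Nat.cast_mul, mul_pow]
  rw [h1]
  refine Finset.dvd_sum fun a _ => ?_
  obtain ⟨k, hk⟩ := Polynomial.powAddExpansion ((c * a : ℕ) : ℤ) (-(m * (c * a / m : ℕ) : ℤ)) n
  have h2 : ((c * a % m : ℕ) : ℤ) = ((c * a : ℕ) : ℤ) + -(m * (c * a / m : ℕ) : ℤ) := by
    have := Nat.mod_add_div (c * a) m
    rw [← sub_eq_add_neg, eq_sub_iff_add_eq]
    exact_mod_cast this
  rw [h2, hk]
  exact ⟨-(k * ((c * a / m : ℕ) : ℤ) ^ 2), by ring⟩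

/-- Voronoi's congruence with `m = p^N`, divided by `n p^N`: the error is an integer times `p^N /
n`, which tends to `0`. -/
theorem tendsto_voronoi {c : ℕ} (hc : Nat.Coprime c p) {n : ℕ} (hn : n ≠ 0) :
    Tendsto (fun N : ℕ => ∑ a ∈ Finset.range (p ^ N),
        ((c * a / p ^ N : ℕ) : ℚ_[p]) * ((c * a : ℕ) : ℚ_[p]) ^ (n - 1)) atTop
      (𝓝 (((c : ℚ_[p]) ^ n - 1) * (((bernoulli n : ℚ) : ℚ_[p]) / n))) := by
  have hp0 : (p : ℚ_[p]) ≠ 0 := by exact_mod_cast hp.out.ne_zero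
  have hn0 : (n : ℚ_[p]) ≠ 0 := by exact_mod_cast hn
  have ht := ((tendsto_sum_range_pow_div (p := p) n).div_const (n : ℚ_[p])).const_mul
    ((c : ℚ_[p]) ^ n - 1)
  refine ht.congr_dist ?_
  have hz : Tendsto (fun N : ℕ => ‖(p : ℚ_[p])‖ ^ N / ‖(n : ℚ_[p])‖) atTop (𝓝 0) := by
    simpa using (tendsto_pow_atTop_nhds_zero_of_lt_one (norm_nonneg _)
      (Padic.norm_p_lt_one (p := p))).div_const ‖(n : ℚ_[p])‖
  refine squeeze_zero (fun _ => dist_nonneg) (fun N => ?_) hz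
  obtain ⟨k, hk⟩ := sq_dvd_voronoi (pow_pos hp.out.pos N) (hc.pow_right N) n
  have hk' := congrArg (fun z : ℤ => (z : ℚ_[p])) hk
  simp only [Int.cast_sub, Int.cast_mul, Int.cast_pow, Int.cast_sum, Int.cast_natCast,
    Int.cast_one, Nat.cast_pow, Nat.cast_mul] at hk'
  rw [dist_eq_norm, ← norm_pow, ← norm_div]
  have e : ((c : ℚ_[p]) ^ n - 1) * ((∑ a ∈ Finset.range (p ^ N), (a : ℚ_[p]) ^ n) / (p : ℚ_[p]) ^ N
        / n) - ∑ a ∈ Finset.range (p ^ N), ((c * a / p ^ N : ℕ) : ℚ_[p]) *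
          ((c * a : ℕ) : ℚ_[p]) ^ (n - 1) = (p : ℚ_[p]) ^ N / n * k := by
    simp only [Nat.cast_mul]
    field_simp
    linear_combination hk'
  rw [e, norm_mul]
  exact mul_le_of_le_one_right (norm_nonneg _) (Padic.norm_int_le_one k)

theorem sum_range_filter_dvd {M : Type*} [AddCommMonoid M] {q : ℕ} (hq : 0 < q) (m : ℕ)
    (f : ℕ → M) :
    ∑ a ∈ (Finset.range (q * m)).filter (q ∣ ·), f a = ∑ a ∈ Finset.range m, f (q * a) := by
  symm
  refine Finset.sum_nbij' (fun a => q * a) (fun a => a / q) ?_ ?_ ?_ ?_ ?_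
  · intro a ha
    simp only [Finset.mem_range, Finset.mem_filter] at ha ⊢
    exact ⟨(Nat.mul_lt_mul_left hq).mpr ha, dvd_mul_right _ _⟩
  · intro a ha
    simp only [Finset.mem_range, Finset.mem_filter] at ha ⊢
    exact Nat.div_lt_of_lt_mul ha.1
  · intro a _
    exact Nat.mul_div_cancel_left a hq
  · intro a ha
    exact Nat.mul_div_cancel' (Finset.mem_filter.mp ha).2
  · simp

/-- The terms with `a = p a'` form `p^(n-1)` times the same sum at level `N`; removing them produces
the Euler factor. Only powers of units remain if also `p ∤ c`. -/
theorem tendsto_voronoi_units {c : ℕ} (hc : Nat.Coprime c p) {n : ℕ} (hn : n ≠ 0) :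
    Tendsto (fun N : ℕ => ∑ a ∈ (Finset.range (p ^ (N + 1))).filter (¬ p ∣ ·),
        ((c * a / p ^ (N + 1) : ℕ) : ℚ_[p]) * ((c * a : ℕ) : ℚ_[p]) ^ (n - 1)) atTop
      (𝓝 (((c : ℚ_[p]) ^ n - 1) *
        ((1 - (p : ℚ_[p]) ^ (n - 1)) * (((bernoulli n : ℚ) : ℚ_[p]) / n)))) := by
  have h := tendsto_voronoi hc hn
  have h1 := (h.comp (tendsto_add_atTop_nat 1)).sub (h.const_mul ((p : ℚ_[p]) ^ (n - 1)))
  convert h1 using 2 with N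
  · rw [Function.comp_apply, eq_sub_iff_add_eq, ← Finset.sum_filter_add_sum_filter_not
      (Finset.range (p ^ (N + 1))) (p ∣ ·) (fun a => ((c * a / p ^ (N + 1) : ℕ) : ℚ_[p]) *
        ((c * a : ℕ) : ℚ_[p]) ^ (n - 1)), add_comm]
    congr 1
    rw [pow_succ', sum_range_filter_dvd hp.out.pos,
      Finset.mul_sum]
    refine Finset.sum_congr rfl fun a _ => ?_
    rw [mul_left_comm c p a, Nat.mul_div_mul_left _ _ hp.out.pos, Nat.cast_mul p, mul_pow]
    ring
  · ring

end PowerSums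

/-! ### The strong Kummer congruence -/

section Kummer

variable {p : ℕ} [hp : Fact p.Prime]

/-- The divided Bernoulli numbers `(1 - p ^ (n - 1)) * B_n / n` at `n = l + (p - 1) * s`. -/
noncomputable def kummerBernoulli (p : ℕ) [Fact p.Prime] (l s : ℕ) : ℚ_[p] :=
  (1 - (p : ℚ_[p]) ^ (l + (p - 1) * s - 1)) *
    (((bernoulli (l + (p - 1) * s) : ℚ) : ℚ_[p]) / (l + (p - 1) * s : ℕ))

variable (p) in
-- Take `c` to be a lift of a primitive root modulo `p`.
theorem exists_norm_pow_sub_one_eq_one :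
    ∃ c : ℕ, Nat.Coprime c p ∧ ∀ n : ℕ, ¬ (p - 1 ∣ n) → ‖(c : ℚ_[p]) ^ n - 1‖ = 1 := by
  obtain ⟨g, hg⟩ := IsCyclic.exists_generator (α := (ZMod p)ˣ)
  have hval : (((g : ZMod p).val : ℕ) : ZMod p) = g := ZMod.natCast_zmod_val _
  refine ⟨(g : ZMod p).val, ZMod.val_coe_unit_coprime g, fun n hn => ?_⟩
  have hord : orderOf g = p - 1 := by
    rw [orderOf_eq_card_of_forall_mem_zpowers hg, Nat.card_eq_fintype_card, ZMod.card_units]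
  have h1 : ¬ (p : ℤ) ∣ (((g : ZMod p).val : ℤ) ^ n - 1) := by
    rw [← ZMod.intCast_zmod_eq_zero_iff_dvd]
    push_cast
    rw [hval, sub_eq_zero]
    intro h
    apply hn
    rw [← hord, orderOf_dvd_iff_pow_eq_one]
    exact Units.ext (by simpa using h)
  refine le_antisymm ?_ (not_lt.mp ?_)
  · exact_mod_cast Padic.norm_int_le_one (p := p) (((g : ZMod p).val : ℤ) ^ n - 1)
  · intro h
    exact h1 (Padic.norm_intCast_lt_one_iff.mp (by exact_mod_cast h))

theorem isKummerFunction_kummerBernoulli {l : ℕ} (hl : ¬ p - 1 ∣ l) :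
    IsKummerFunction p (kummerBernoulli p l) := by
  have hp2 : p ≠ 2 := by
    rintro rfl
    simp at hl
  have hl0 : l ≠ 0 := by
    rintro rfl
    simp at hl
  obtain ⟨c, hc, hc1⟩ := exists_norm_pow_sub_one_eq_one p
  have hcp : ¬ p ∣ c := fun h => hp.out.one_lt.ne' (Nat.eq_one_of_dvd_coprimes hc h dvd_rfl)
  have hn : ∀ s, ‖(c : ℚ_[p]) ^ (l + (p - 1) * s) - 1‖ = 1 := fun s =>
    hc1 _ (by rwa [Nat.dvd_add_left (dvd_mul_right _ _)])
  have hD : IsKummerFunction p (fun s => (c : ℚ_[p]) ^ (l + (p - 1) * s) - 1) :=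
    (IsKummerFunction.natCast_pow hp2 hcp l).sub_const (by simp)
  have hG : IsKummerFunction p
      (fun s => ((c : ℚ_[p]) ^ (l + (p - 1) * s) - 1) * kummerBernoulli p l s) := by
    refine IsKummerFunction.of_tendsto (fun N => ?_)
      fun s => tendsto_voronoi_units hc (n := l + (p - 1) * s) (by omega)
    refine IsKummerFunction.sum _ _ _ (fun a _ => Padic.norm_natCast_le_one _)
      fun a ha => ?_
    have hca : ¬ p ∣ c * a := by
      rw [hp.out.dvd_mul, not_or]
      exact ⟨hcp, (Finset.mem_filter.mp ha).2⟩
    have := IsKummerFunction.natCast_pow hp2 hca (l - 1)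
    convert this using 3 with s
    omega
  have := hG.div hD hn
  -- Divide out the unit-valued Kummer function `c^n - 1`.
  refine cast (congrArg _ (funext fun s => ?_)) this
  have h0 : (c : ℚ_[p]) ^ (l + (p - 1) * s) - 1 ≠ 0 :=
    norm_ne_zero_iff.mp (by rw [hn]; exact one_ne_zero)
  exact mul_div_cancel_left₀ _ h0

theorem norm_kummerBernoulli {l : ℕ} (hl : 2 ≤ l) (s : ℕ) :
    ‖kummerBernoulli p l s‖ =
      ‖((bernoulli (l + (p - 1) * s) : ℚ) : ℚ_[p]) / (l + (p - 1) * s : ℕ)‖ := by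
  have h1 : ‖(p : ℚ_[p]) ^ (l + (p - 1) * s - 1)‖ < 1 := by
    rw [norm_pow]
    exact pow_lt_one₀ (norm_nonneg _) Padic.norm_p_lt_one (by omega)
  have h2 : ‖1 - (p : ℚ_[p]) ^ (l + (p - 1) * s - 1)‖ = 1 := by
    have := Padic.norm_eq_of_norm_sub_lt_left (z1 := (1 : ℚ_[p]))
      (z2 := 1 - (p : ℚ_[p]) ^ (l + (p - 1) * s - 1)) (by simpa using h1)
    rw [← this, norm_one]
  rw [kummerBernoulli, norm_mul, h2, one_mul]

end Kummer

/-! ### Valuations, and the zero of a Kummer function -/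

section Digits

variable {p : ℕ} [hp : Fact p.Prime]

theorem Padic.le_norm_p_pow_succ_of_lt {x : ℚ_[p]} {n : ℕ} (h : ‖x‖ < ‖(p : ℚ_[p])‖ ^ n) :
    ‖x‖ ≤ ‖(p : ℚ_[p])‖ ^ (n + 1) := by
  have h1 := (Padic.norm_lt_pow_iff_norm_le_pow_sub_one x (-n)).mp
    (by rwa [Padic.norm_p, inv_pow, ← zpow_natCast, ← zpow_neg] at h)
  rwa [Padic.norm_p, inv_pow, ← zpow_natCast, ← zpow_neg, Nat.cast_add, Nat.cast_one, neg_add]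

theorem Padic.norm_p_pos : 0 < ‖(p : ℚ_[p])‖ :=
  norm_pos_iff.mpr (by exact_mod_cast hp.out.ne_zero)

theorem Padic.norm_p_pow_le_norm_p_pow {a b : ℕ} (h : a ≤ b) :
    ‖(p : ℚ_[p])‖ ^ b ≤ ‖(p : ℚ_[p])‖ ^ a :=
  pow_le_pow_of_le_one (norm_nonneg _) Padic.norm_p_lt_one.le h

theorem Padic.norm_p_pow_le_iff {a b : ℕ} :
    ‖(p : ℚ_[p])‖ ^ b ≤ ‖(p : ℚ_[p])‖ ^ a ↔ a ≤ b :=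
  pow_le_pow_iff_right_of_lt_one₀ Padic.norm_p_pos Padic.norm_p_lt_one

theorem Padic.exists_norm_eq_pow {x : ℚ_[p]} (h0 : x ≠ 0) (h1 : ‖x‖ ≤ 1) :
    ∃ v : ℕ, ‖x‖ = ‖(p : ℚ_[p])‖ ^ v := by
  have hv := (Padic.norm_le_one_iff_val_nonneg x).mp h1
  refine ⟨x.valuation.toNat, ?_⟩
  rw [Padic.norm_eq_zpow_neg_valuation h0, Padic.norm_p, inv_pow, ← zpow_natCast,
    Int.toNat_of_nonneg hv, zpow_neg]

/-- For `r ≥ 1`, divisibility of the reduced numerator forces the denominator to be a unit. For `r =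
0` the left side would not detect integrality. -/
theorem Padic.pow_dvd_num_iff {r : ℕ} (hr : 1 ≤ r) (q : ℚ) :
    (p : ℤ) ^ r ∣ q.num ↔ ‖(q : ℚ_[p])‖ ≤ ‖(p : ℚ_[p])‖ ^ r := by
  have hd : (q.den : ℚ_[p]) ≠ 0 := by exact_mod_cast q.den_nz
  have hq : (q : ℚ_[p]) * q.den = q.num := by
    exact_mod_cast congrArg (fun x : ℚ => (x : ℚ_[p])) (Rat.mul_den_eq_num q)
  have hnum : (p : ℤ) ^ r ∣ q.num ↔ ‖(q.num : ℚ_[p])‖ ≤ ‖(p : ℚ_[p])‖ ^ r := by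
    have := Padic.norm_int_le_pow_iff_dvd (p := p) q.num r
    rw [Padic.norm_p, inv_pow, ← zpow_natCast, ← zpow_neg, this]
  constructor
  · intro h
    have h1 : ‖(q.den : ℚ_[p])‖ = 1 := by
      rw [Padic.norm_natCast_eq_one_iff]
      have h2 : p ∣ q.num.natAbs :=
        Int.natCast_dvd.mp ((dvd_pow_self _ (by omega)).trans h)
      exact Nat.Coprime.coprime_dvd_left h2 q.reduced
    have h2 := hnum.mp h
    rwa [← hq, norm_mul, h1, mul_one] at h2
  · intro h
    rw [hnum, ← hq, norm_mul]
    exact (mul_le_of_le_one_right (norm_nonneg _)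
      (Padic.norm_natCast_le_one _)).trans h

theorem ratResidue_eq_zero_iff {q : ℚ} (hq : ‖(q : ℚ_[p])‖ ≤ 1) :
    ratResidue p q = 0 ↔ ‖(q : ℚ_[p])‖ < 1 := by
  have hd : ¬ p ∣ q.den := by
    intro h
    have h1 : ‖(q.den : ℚ_[p])‖ < 1 := Padic.norm_natCast_lt_one_iff.mpr h
    have h2 : (q : ℚ_[p]) * q.den = q.num := by
      exact_mod_cast congrArg (fun x : ℚ => (x : ℚ_[p])) (Rat.mul_den_eq_num q)
    have h3 : ‖(q.num : ℚ_[p])‖ < 1 := by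
      rw [← h2, norm_mul]
      exact (mul_le_of_le_one_left (norm_nonneg _) hq).trans_lt h1
    have h4 : p ∣ q.num.natAbs := Int.natCast_dvd.mp (Padic.norm_intCast_lt_one_iff.mp h3)
    exact hp.out.one_lt.ne' (Nat.eq_one_of_dvd_coprimes q.reduced h4 h)
  have hd' : (q.den : ZMod p) ≠ 0 := by rwa [Ne, ZMod.natCast_eq_zero_iff]
  have hlt : ‖(q : ℚ_[p])‖ < 1 ↔ ‖(q : ℚ_[p])‖ ≤ ‖(p : ℚ_[p])‖ ^ 1 := by
    refine ⟨fun h => ?_, fun h => h.trans_lt (by rw [pow_one]; exact Padic.norm_p_lt_one)⟩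
    exact Padic.le_norm_p_pow_succ_of_lt (n := 0) (by rwa [pow_zero])
  rw [hlt, ← Padic.pow_dvd_num_iff le_rfl, ratResidue, ZMod.val_eq_zero, mul_eq_zero, inv_eq_zero,
    or_iff_left hd', ZMod.intCast_zmod_eq_zero_iff_dvd, pow_one]

theorem sum_digits_lt {p : ℕ} {d : ℕ → ℕ} (hd : ∀ i, d i < p) (r : ℕ) :
    ∑ i ∈ Finset.range r, d i * p ^ i < p ^ r := by
  induction r with
  | zero => simp
  | succ r ih =>
    rw [Finset.sum_range_succ, pow_succ']
    have : (d r + 1) * p ^ r ≤ p * p ^ r := Nat.mul_le_mul_right _ (hd r)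
    rw [add_mul, one_mul] at this
    omega

namespace IsKummerFunction

variable {F : ℕ → ℚ_[p]}

theorem norm_sub_eq (hF : IsKummerFunction p F)
    (hA : ‖F 1 - F 0‖ = ‖(p : ℚ_[p])‖) (s t : ℕ) :
    ‖F s - F t‖ = ‖(p : ℚ_[p]) * ((s : ℚ_[p]) - t)‖ := by
  rcases eq_or_ne s t with rfl | hst
  · simp
  have h0 : 0 < ‖(s : ℚ_[p]) - t‖ := norm_pos_iff.mpr (sub_ne_zero.mpr (by exact_mod_cast hst))
  have h1 : ‖((s : ℚ_[p]) - t) * (F 1 - F 0)‖ = ‖(p : ℚ_[p]) * ((s : ℚ_[p]) - t)‖ := by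
    rw [norm_mul, norm_mul, hA, mul_comm]
  rw [← h1]
  refine Padic.norm_eq_of_norm_sub_lt_right ((hF.norm_sub_sub_le s t).trans_lt ?_)
  rw [h1, norm_mul, norm_mul, norm_pow, sq]
  refine mul_lt_mul_of_pos_right ?_ h0
  exact mul_lt_of_lt_one_right Padic.norm_p_pos Padic.norm_p_lt_one

theorem norm_sub_le_of_norm_slope_lt (hF : IsKummerFunction p F)
    (hA : ‖F 1 - F 0‖ < ‖(p : ℚ_[p])‖) (s t : ℕ) :
    ‖F s - F t‖ ≤ ‖(p : ℚ_[p]) ^ 2 * ((s : ℚ_[p]) - t)‖ := by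
  have h1 : ‖((s : ℚ_[p]) - t) * (F 1 - F 0)‖ ≤ ‖(p : ℚ_[p]) ^ 2 * ((s : ℚ_[p]) - t)‖ := by
    rw [norm_mul, norm_mul, mul_comm, norm_pow]
    exact mul_le_mul_of_nonneg_right
      (Padic.le_norm_p_pow_succ_of_lt (n := 1) (by rwa [pow_one])) (norm_nonneg _)
  have := Padic.norm_add_le_of_le (hF.norm_sub_sub_le s t) h1
  rwa [sub_add_cancel] at this

/-- A Hensel step: `F(t + j p^r) ≡ F(t) + j p^r A` modulo `p^(r+2)`, so `j` is the residue of `-F(t)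
/ (p^r A)`, which is integral because `|p^r A| = |p|^(r+1)`. -/
theorem exists_digit (hF : IsKummerFunction p F)
    (hA : ‖F 1 - F 0‖ = ‖(p : ℚ_[p])‖) {t r : ℕ}
    (ht : ‖F t‖ ≤ ‖(p : ℚ_[p])‖ ^ (r + 1)) :
    ∃ j < p, ‖F (t + j * p ^ r)‖ ≤ ‖(p : ℚ_[p])‖ ^ (r + 2) := by
  have hp0 : (p : ℚ_[p]) ≠ 0 := by exact_mod_cast hp.out.ne_zero
  set A := F 1 - F 0 with hAdef
  have hA0 : A ≠ 0 := norm_ne_zero_iff.mp (by rw [hA]; exact Padic.norm_p_pos.ne')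
  have hx : ‖-(F t / ((p : ℚ_[p]) ^ r * A))‖ ≤ 1 := by
    rw [norm_neg, norm_div, norm_mul, norm_pow, hA, ← pow_succ]
    exact div_le_one_of_le₀ ht (by positivity)
  obtain ⟨x, hxF⟩ : ∃ x : ℤ_[p], (x : ℚ_[p]) = -(F t / ((p : ℚ_[p]) ^ r * A)) := ⟨⟨_, hx⟩, rfl⟩
  obtain ⟨j, hj, hjm⟩ := PadicInt.exists_mem_range x
  refine ⟨j, hj, ?_⟩
  have hlt : ‖-(F t / ((p : ℚ_[p]) ^ r * A)) - j‖ ≤ ‖(p : ℚ_[p])‖ ^ 1 := by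
    refine Padic.le_norm_p_pow_succ_of_lt (n := 0) ?_
    rw [pow_zero]
    have := PadicInt.mem_nonunits.mp ((IsLocalRing.mem_maximalIdeal _).mp hjm)
    rw [PadicInt.norm_def, PadicInt.coe_sub, PadicInt.coe_natCast, hxF] at this
    exact this
  have h1 := hF.norm_sub_sub_le (t + j * p ^ r) t
  have e1 : ((t + j * p ^ r : ℕ) : ℚ_[p]) - t = j * (p : ℚ_[p]) ^ r := by push_cast; ring
  rw [e1] at h1
  have h2 : ‖(p : ℚ_[p]) ^ 2 * (j * (p : ℚ_[p]) ^ r)‖ ≤ ‖(p : ℚ_[p])‖ ^ (r + 2) := by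
    rw [norm_mul, norm_mul, norm_pow, norm_pow, pow_add, mul_comm, mul_assoc]
    exact mul_le_of_le_one_left (by positivity) (Padic.norm_natCast_le_one j)
  have h3 : ‖(p : ℚ_[p]) ^ r * A * (-(F t / ((p : ℚ_[p]) ^ r * A)) - j)‖ ≤
      ‖(p : ℚ_[p])‖ ^ (r + 2) := by
    rw [norm_mul, norm_mul, norm_pow, hA, pow_add, sq, ← mul_assoc]
    rw [pow_one] at hlt
    gcongr
  have h4 := Padic.norm_sub_le_of_le (h1.trans h2) h3
  convert h4 using 2
  field_simp
  ring

theorem exists_digits (hF : IsKummerFunction p F)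
    (hA : ‖F 1 - F 0‖ = ‖(p : ℚ_[p])‖) (h0 : ‖F 0‖ ≤ ‖(p : ℚ_[p])‖) :
    ∃ d : ℕ → ℕ, (∀ i, d i < p) ∧
      ∀ r, ‖F (∑ i ∈ Finset.range r, d i * p ^ i)‖ ≤ ‖(p : ℚ_[p])‖ ^ (r + 1) := by
  classical
  choose! j hj1 hj2 using fun (r t : ℕ) (ht : ‖F t‖ ≤ ‖(p : ℚ_[p])‖ ^ (r + 1)) =>
    hF.exists_digit hA ht
  let T : ℕ → ℕ := fun r => Nat.rec 0 (fun r t => t + j r t * p ^ r) r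
  have hT : ∀ r, ‖F (T r)‖ ≤ ‖(p : ℚ_[p])‖ ^ (r + 1) := by
    intro r
    induction r with
    | zero => simpa [T] using h0
    | succ r ih => exact hj2 r (T r) ih
  have hsum : ∀ r, ∑ i ∈ Finset.range r, j i (T i) * p ^ i = T r := by
    intro r
    induction r with
    | zero => rfl
    | succ r ih => rw [Finset.sum_range_succ, ih]
  exact ⟨fun i => j i (T i), fun i => hj1 i (T i) (hT i), fun r => by rw [hsum]; exact hT r⟩

/-- Since `|F t - F u| = |p (t - u)|`, two partial sums at which `F` vanishes modulo `p^(r+1)` agree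
modulo `p^r`, hence are equal, both being below `p^r`. -/
theorem digits_unique (hF : IsKummerFunction p F)
    (hA : ‖F 1 - F 0‖ = ‖(p : ℚ_[p])‖) {d e : ℕ → ℕ}
    (hd : ∀ i, d i < p) (he : ∀ i, e i < p)
    (hd' : ∀ r, ‖F (∑ i ∈ Finset.range r, d i * p ^ i)‖ ≤ ‖(p : ℚ_[p])‖ ^ (r + 1))
    (he' : ∀ r, ‖F (∑ i ∈ Finset.range r, e i * p ^ i)‖ ≤ ‖(p : ℚ_[p])‖ ^ (r + 1)) :
    d = e := by
  have h : ∀ r, ∑ i ∈ Finset.range r, d i * p ^ i = ∑ i ∈ Finset.range r, e i * p ^ i := by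
    intro r
    set t := ∑ i ∈ Finset.range r, d i * p ^ i with ht
    set u := ∑ i ∈ Finset.range r, e i * p ^ i with hu
    have h1 := Padic.norm_sub_le_of_le (hd' r) (he' r)
    rw [hF.norm_sub_eq hA, norm_mul, pow_succ'] at h1
    have h2 := le_of_mul_le_mul_left h1 Padic.norm_p_pos
    rw [Padic.norm_p, inv_pow, ← zpow_natCast, ← zpow_neg] at h2
    have h3 := (Padic.norm_int_le_pow_iff_dvd (p := p) ((t : ℤ) - u) r).mp (by exact_mod_cast h2)
    have h4 : u ≡ t [MOD p ^ r] := (Nat.modEq_iff_dvd).mpr (by exact_mod_cast h3)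
    exact (h4.eq_of_lt_of_lt (sum_digits_lt he r) (sum_digits_lt hd r)).symm
  funext r
  have h1 := h (r + 1)
  rw [Finset.sum_range_succ, Finset.sum_range_succ, h r] at h1
  exact Nat.eq_of_mul_eq_mul_right (pow_pos hp.out.pos r) (Nat.add_left_cancel h1)

/-- Along the partial sums `F` tends to `0`, so the isometry `|F t - F s| = |p (t - s)|` passes to
the limit. -/
theorem norm_eq_of_digits (hF : IsKummerFunction p F)
    (hA : ‖F 1 - F 0‖ = ‖(p : ℚ_[p])‖) {d : ℕ → ℕ}
    (hd : ∀ r, ‖F (∑ i ∈ Finset.range r, d i * p ^ i)‖ ≤ ‖(p : ℚ_[p])‖ ^ (r + 1)) (s : ℕ) :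
    ‖F s‖ = ‖(p : ℚ_[p]) *
      (((∑' i : ℕ, (d i : ℤ_[p]) * (p : ℤ_[p]) ^ i : ℤ_[p]) : ℚ_[p]) - s)‖ := by
  have hsum : Summable (fun i : ℕ => (d i : ℤ_[p]) * (p : ℤ_[p]) ^ i) := by
    refine Summable.of_norm_bounded
      (summable_geometric_of_lt_one (norm_nonneg (p : ℤ_[p])) (by
        simpa [PadicInt.norm_def] using Padic.norm_p_lt_one (p := p))) fun i => ?_
    rw [norm_mul, norm_pow]
    exact mul_le_of_le_one_left (by positivity) (PadicInt.norm_le_one _)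
  have ht := hsum.hasSum.tendsto_sum_nat
  have ht' := ((continuous_subtype_val (p := fun x : ℚ_[p] => ‖x‖ ≤ 1)).tendsto _).comp ht
  have hp0 := tendsto_pow_atTop_nhds_zero_of_lt_one (norm_nonneg (p : ℚ_[p])) Padic.norm_p_lt_one
  have hz : Filter.Tendsto (fun r => F (∑ i ∈ Finset.range r, d i * p ^ i)) Filter.atTop
      (nhds 0) :=
    squeeze_zero_norm hd (hp0.comp (Filter.tendsto_add_atTop_nat 1))
  have h1 := (hz.sub_const (F s)).norm
  have h2 := ((ht'.sub_const (s : ℚ_[p])).const_mul (p : ℚ_[p])).norm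
  rw [zero_sub, norm_neg] at h1
  refine tendsto_nhds_unique h1 (h2.congr fun r => ?_)
  have e : ((∑ i ∈ Finset.range r, (d i : ℤ_[p]) * (p : ℤ_[p]) ^ i : ℤ_[p]) : ℚ_[p]) =
      ((∑ i ∈ Finset.range r, d i * p ^ i : ℕ) : ℚ_[p]) := by
    rw [← PadicInt.coe_natCast]
    push_cast
    rfl
  rw [hF.norm_sub_eq hA, ← e]
  rfl

end IsKummerFunction

end Digits

/-! ### Irregular pairs, digits and trees in terms of `kummerBernoulli` -/

section IrregularPairs

variable {p : Nat.Primes} {l : ℕ}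

theorem mem_irregularPairs_iff_norm {r m : ℕ} (hr : 1 ≤ r) :
    (p, m) ∈ irregularPairs r ↔ 2 ≤ m ∧ m < Nat.totient ((p : ℕ) ^ r) ∧ Even m ∧
      ‖((bernoulli m : ℚ) : ℚ_[p]) / (m : ℕ)‖ ≤ ‖((p : ℕ) : ℚ_[p])‖ ^ r := by
  have h := Padic.pow_dvd_num_iff (p := (p : ℕ)) hr (bernoulli m / (m : ℚ))
  rw [Rat.cast_div, Rat.cast_natCast] at h
  rw [← h]
  rfl

theorem bounds_of_mem_irregularPairs (h : (p, l) ∈ irregularPairs 1) :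
    2 ≤ l ∧ l < (p : ℕ) - 1 ∧ Even l := by
  obtain ⟨h1, h2, h3, -⟩ := h
  rw [pow_one, Nat.totient_prime p.2] at h2
  exact ⟨h1, h2, h3⟩

theorem even_sub_one_of_bounds (h2 : 2 ≤ l) (hl : l < (p : ℕ) - 1) : Even ((p : ℕ) - 1) :=
  p.2.even_sub_one (by rintro h; omega)

theorem totient_prime_pow_succ (p : Nat.Primes) (r : ℕ) :
    Nat.totient ((p : ℕ) ^ (r + 1)) = ((p : ℕ) - 1) * (p : ℕ) ^ r := by
  rw [Nat.totient_prime_pow_succ p.2, mul_comm]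

theorem add_mul_lt_mul_pow_iff (hl : l < (p : ℕ) - 1) (s P : ℕ) :
    l + ((p : ℕ) - 1) * s < ((p : ℕ) - 1) * P ↔ s < P := by
  constructor
  · intro h
    exact lt_of_mul_lt_mul_left ((Nat.le_add_left _ _).trans_lt h) (Nat.zero_le _)
  · intro h
    calc l + ((p : ℕ) - 1) * s < ((p : ℕ) - 1) * (s + 1) := by rw [mul_add, mul_one]; omega
      _ ≤ ((p : ℕ) - 1) * P := Nat.mul_le_mul_left _ h

/-- The dictionary used throughout: a pair of order `r + 1` above `(p, l)` is a residue `s` modulo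
`p^r` at which `F` vanishes modulo `p^(r+1)`. -/
theorem mem_irregularPairs_add_mul_iff (h2 : 2 ≤ l) (hl : l < (p : ℕ) - 1) (he : Even l)
    (r s : ℕ) :
    (p, l + ((p : ℕ) - 1) * s) ∈ irregularPairs (r + 1) ↔
      s < (p : ℕ) ^ r ∧ ‖kummerBernoulli p l s‖ ≤ ‖((p : ℕ) : ℚ_[p])‖ ^ (r + 1) := by
  rw [mem_irregularPairs_iff_norm (by omega), norm_kummerBernoulli h2, totient_prime_pow_succ,
    add_mul_lt_mul_pow_iff hl]
  have h3 : 2 ≤ l + ((p : ℕ) - 1) * s := by omega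
  have h4 : Even (l + ((p : ℕ) - 1) * s) := he.add ((even_sub_one_of_bounds h2 hl).mul_right _)
  tauto

theorem not_dvd_of_bounds (h2 : 2 ≤ l) (hl : l < (p : ℕ) - 1) : ¬ (p : ℕ) - 1 ∣ l :=
  Nat.not_dvd_of_pos_of_lt (by omega) hl

theorem isKummerFunction_of_bounds (h2 : 2 ≤ l) (hl : l < (p : ℕ) - 1) :
    IsKummerFunction p (kummerBernoulli p l) :=
  isKummerFunction_kummerBernoulli (not_dvd_of_bounds h2 hl)

theorem mem_irregularPairs_one_iff (h2 : 2 ≤ l) (hl : l < (p : ℕ) - 1) (he : Even l) :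
    (p, l) ∈ irregularPairs 1 ↔ ‖kummerBernoulli p l 0‖ ≤ ‖((p : ℕ) : ℚ_[p])‖ := by
  have := mem_irregularPairs_add_mul_iff h2 hl he 0 0
  simpa using this

/-- `Δ` is defined without Euler factors. As `B_l / l` and its successor are divisible by `p`,
inserting the factors alters the difference only by multiples of `p²`. -/
theorem irrDelta_eq_zero_iff (h : (p, l) ∈ irregularPairs 1) :
    irrDelta 1 p l = 0 ↔
      ‖kummerBernoulli p l 1 - kummerBernoulli p l 0‖ < ‖((p : ℕ) : ℚ_[p])‖ := by
  obtain ⟨h2, hl, he⟩ := bounds_of_mem_irregularPairs h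
  have hF := isKummerFunction_of_bounds h2 hl
  have hF0 := (mem_irregularPairs_one_iff h2 hl he).mp h
  have hp0 : ((p : ℕ) : ℚ_[p]) ≠ 0 := by exact_mod_cast p.2.ne_zero
  set π : ℚ_[p] := ((p : ℕ) : ℚ_[p]) with hπ
  have hπ0 : 0 < ‖π‖ := norm_pos_iff.mpr hp0
  have hF1 : ‖kummerBernoulli p l 1‖ ≤ ‖π‖ := by
    have := Padic.norm_add_le_of_le (hF.norm_sub_le_norm_p 1 0) hF0
    rwa [sub_add_cancel] at this
  have hb0 := norm_kummerBernoulli (p := p) h2 0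
  have hb1 := norm_kummerBernoulli (p := p) h2 1
  set b0 : ℚ_[p] := ((bernoulli l : ℚ) : ℚ_[p]) / (l : ℕ) with hb0'
  set b1 : ℚ_[p] := ((bernoulli (l + ((p : ℕ) - 1)) : ℚ) : ℚ_[p]) / (l + ((p : ℕ) - 1) : ℕ)
    with hb1'
  rw [mul_zero, add_zero, ← hb0'] at hb0
  rw [mul_one, ← hb1'] at hb1
  have e0 : kummerBernoulli p l 0 = (1 - π ^ (l - 1)) * b0 := by
    simp [kummerBernoulli, hb0', hπ]
  have e1 : kummerBernoulli p l 1 = (1 - π ^ (l + ((p : ℕ) - 1) - 1)) * b1 := by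
    simp [kummerBernoulli, hb1', hπ]
  have key : ∀ (k : ℕ) (x : ℚ_[p]), 1 ≤ k → ‖x‖ ≤ ‖π‖ → ‖π ^ k * x‖ < ‖π‖ := by
    intro k x hk hx
    rw [norm_mul, norm_pow]
    calc ‖π‖ ^ k * ‖x‖ ≤ ‖π‖ ^ k * ‖π‖ := by gcongr
      _ < ‖π‖ := mul_lt_of_lt_one_left hπ0
        (pow_lt_one₀ (norm_nonneg _) Padic.norm_p_lt_one (by omega))
  have hd : ‖(b1 - b0) - (kummerBernoulli p l 1 - kummerBernoulli p l 0)‖ < ‖π‖ := by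
    have : (b1 - b0) - (kummerBernoulli p l 1 - kummerBernoulli p l 0) =
        π ^ (l + ((p : ℕ) - 1) - 1) * b1 + -(π ^ (l - 1) * b0) := by
      rw [e0, e1]; ring
    rw [this]
    refine (Padic.nonarchimedean _ _).trans_lt (max_lt ?_ ?_)
    · exact key _ _ (by omega) (hb1 ▸ hF1)
    · rw [norm_neg]
      exact key _ _ (by omega) (hb0 ▸ hF0)
  have hiff : ‖b1 - b0‖ < ‖π‖ ↔
      ‖kummerBernoulli p l 1 - kummerBernoulli p l 0‖ < ‖π‖ := by
    constructor
    · intro h'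
      have := (Padic.nonarchimedean (b1 - b0)
        (-((b1 - b0) - (kummerBernoulli p l 1 - kummerBernoulli p l 0)))).trans_lt
        (max_lt h' (by rwa [norm_neg]))
      rwa [← sub_eq_add_neg, sub_sub_cancel] at this
    · intro h'
      have := (Padic.nonarchimedean _ _).trans_lt (max_lt hd h')
      rwa [sub_add_cancel] at this
  have hle : ‖b1 - b0‖ ≤ ‖π‖ :=
    Padic.norm_sub_le_of_le (hb1 ▸ hF1) (hb0 ▸ hF0)
  have hcast : (((bernoulli (l + Nat.totient ((p : ℕ) ^ 1)) /
      ((l + Nat.totient ((p : ℕ) ^ 1) : ℕ) : ℚ) - bernoulli l / (l : ℚ)) / ((p : ℕ) : ℚ) ^ 1 : ℚ) :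
      ℚ_[p]) = (b1 - b0) / π := by
    rw [pow_one, pow_one, Nat.totient_prime p.2, Rat.cast_div, Rat.cast_sub, Rat.cast_div,
      Rat.cast_div]
    simp only [Rat.cast_natCast, hb1', hb0', hπ]
  rw [irrDelta, ratResidue_eq_zero_iff (p := (p : ℕ)), hcast, norm_div, div_lt_one hπ0, hiff]
  rw [hcast, norm_div]
  exact div_le_one_of_le₀ hle hπ0.le

theorem norm_slope_eq_of_irrDelta_ne_zero (h : (p, l) ∈ irregularPairs 1)
    (hΔ : irrDelta 1 p l ≠ 0) :
    ‖kummerBernoulli p l 1 - kummerBernoulli p l 0‖ = ‖((p : ℕ) : ℚ_[p])‖ := by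
  obtain ⟨h2, hl, -⟩ := bounds_of_mem_irregularPairs h
  exact le_antisymm (isKummerFunction_of_bounds h2 hl).norm_slope_le
    (not_lt.mp (mt (irrDelta_eq_zero_iff h).mpr hΔ))

/-- Because `φ(1) = 1` and `φ(p^(i+1)) = (p - 1)p^i`, the digits after the first are ordinary
base-`p` digits of the parameter. -/
theorem sum_mul_totient (p : Nat.Primes) (s : ℕ → ℕ) (r : ℕ) :
    ∑ i ∈ Finset.range (r + 1), s i * Nat.totient ((p : ℕ) ^ i) =
      s 0 + ((p : ℕ) - 1) * ∑ i ∈ Finset.range r, s (i + 1) * (p : ℕ) ^ i := by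
  rw [Finset.sum_range_succ', Finset.mul_sum, add_comm]
  congr 1
  · simp
  · refine Finset.sum_congr rfl fun i _ => ?_
    rw [totient_prime_pow_succ]
    ring

theorem isIrrDigits_iff (h : (p, l) ∈ irregularPairs 1) (s : ℕ → ℕ) :
    IsIrrDigits p l s ↔ s 0 = l ∧ (∀ i, s (i + 1) < (p : ℕ)) ∧
      ∀ r, ‖kummerBernoulli p l (∑ i ∈ Finset.range r, s (i + 1) * (p : ℕ) ^ i)‖ ≤
        ‖((p : ℕ) : ℚ_[p])‖ ^ (r + 1) := by
  obtain ⟨h2, hl, he⟩ := bounds_of_mem_irregularPairs h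
  constructor
  · rintro ⟨h0, h1, h3⟩
    refine ⟨h0, fun i => h1 (i + 1), fun r => ?_⟩
    have := h3 (r + 1) (by omega)
    rw [sum_mul_totient, h0] at this
    exact ((mem_irregularPairs_add_mul_iff h2 hl he _ _).mp this).2
  · rintro ⟨h0, h1, h3⟩
    refine ⟨h0, fun i => ?_, fun r hr => ?_⟩
    · rcases i with _ | i
      · omega
      · exact h1 i
    · obtain ⟨r, rfl⟩ := Nat.exists_eq_add_of_le' hr
      rw [sum_mul_totient, h0]
      exact (mem_irregularPairs_add_mul_iff h2 hl he _ _).mpr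
        ⟨sum_digits_lt (d := fun i => s (i + 1)) h1 r, h3 r⟩

theorem existsUnique_isIrrDigits (h : (p, l) ∈ irregularPairs 1) (hΔ : irrDelta 1 p l ≠ 0) :
    ∃! s, IsIrrDigits p l s := by
  obtain ⟨h2, hl, he⟩ := bounds_of_mem_irregularPairs h
  have hF := isKummerFunction_of_bounds h2 hl
  have hA := norm_slope_eq_of_irrDelta_ne_zero h hΔ
  obtain ⟨d, hd1, hd2⟩ := hF.exists_digits hA ((mem_irregularPairs_one_iff h2 hl he).mp h)
  obtain ⟨e, he0, hed⟩ : ∃ e : ℕ → ℕ, e 0 = l ∧ ∀ i, e (i + 1) = d i :=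
    ⟨fun i => Nat.rec l (fun i _ => d i) i, rfl, fun _ => rfl⟩
  refine ⟨e, (isIrrDigits_iff h e).mpr ⟨he0, ?_, ?_⟩, fun s hs => ?_⟩
  · simpa only [hed] using hd1
  · simpa only [hed] using hd2
  · obtain ⟨hs0, hs1, hs2⟩ := (isIrrDigits_iff h s).mp hs
    have := hF.digits_unique hA (d := fun i => s (i + 1)) hs1 hd1 hs2 hd2
    funext i
    rcases i with _ | i
    · rw [hs0, he0]
    · rw [hed, ← this]

theorem norm_kummerBernoulli_eq_of_irrDelta_ne_zero (h : (p, l) ∈ irregularPairs 1)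
    (hΔ : irrDelta 1 p l ≠ 0) (s : ℕ) :
    ‖kummerBernoulli p l s‖ =
      ‖((p : ℕ) : ℚ_[p]) * ((irrChi p l : ℚ_[p]) - (s : ℚ_[p]))‖ := by
  obtain ⟨h2, hl, he⟩ := bounds_of_mem_irregularPairs h
  have hex := (existsUnique_isIrrDigits h hΔ).exists
  rw [irrChi, dif_pos hex]
  exact (isKummerFunction_of_bounds h2 hl).norm_eq_of_digits
    (norm_slope_eq_of_irrDelta_ne_zero h hΔ) ((isIrrDigits_iff h _).mp hex.choose_spec).2.2 s

theorem norm_kummerBernoulli_sub_le_of_irrDelta_eq_zero (h : (p, l) ∈ irregularPairs 1)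
    (hΔ : irrDelta 1 p l = 0) {s t r : ℕ} (hst : s ≡ t [MOD (p : ℕ) ^ r]) :
    ‖kummerBernoulli p l s - kummerBernoulli p l t‖ ≤ ‖((p : ℕ) : ℚ_[p])‖ ^ (r + 2) := by
  obtain ⟨h2, hl, -⟩ := bounds_of_mem_irregularPairs h
  have h1 := (isKummerFunction_of_bounds h2 hl).norm_sub_le_of_norm_slope_lt
    ((irrDelta_eq_zero_iff h).mp hΔ) s t
  obtain ⟨k, hk⟩ := (Nat.modEq_iff_dvd).mp hst.symm
  have hk' : (s : ℚ_[p]) - t = ((p : ℕ) : ℚ_[p]) ^ r * k := by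
    have := congrArg (fun z : ℤ => (z : ℚ_[p])) hk
    push_cast at this
    exact this
  rw [hk'] at h1
  refine h1.trans ?_
  rw [norm_mul, norm_mul, norm_pow, norm_pow, ← mul_assoc, ← pow_add, add_comm]
  exact mul_le_of_le_one_right (by positivity) (Padic.norm_int_le_one k)

theorem norm_kummerBernoulli_le_iff_of_irrDelta_eq_zero (h : (p, l) ∈ irregularPairs 1)
    (hΔ : irrDelta 1 p l = 0) {s t r k : ℕ} (hst : s ≡ t [MOD (p : ℕ) ^ r]) (hk : k ≤ r + 2) :
    ‖kummerBernoulli p l s‖ ≤ ‖((p : ℕ) : ℚ_[p])‖ ^ k ↔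
      ‖kummerBernoulli p l t‖ ≤ ‖((p : ℕ) : ℚ_[p])‖ ^ k := by
  have h1 := (norm_kummerBernoulli_sub_le_of_irrDelta_eq_zero h hΔ hst).trans
    (Padic.norm_p_pow_le_norm_p_pow hk)
  constructor
  · intro hs
    have := Padic.norm_sub_le_of_le hs h1
    rwa [sub_sub_cancel] at this
  · intro ht
    have := Padic.norm_add_le_of_le h1 ht
    rwa [sub_add_cancel] at this

/-- A child's parameter is congruent to its parent's modulo `p^r`, so `F` takes the same value
modulo `p^(r+2)` at both. The condition for having children is thus exactly the vanishing required
of each child. Conversely, the parent of `s` is `s mod p^r`, and the branch is `s / p^r`. -/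
theorem irrNode_iff (h : (p, l) ∈ irregularPairs 1) (hΔ : irrDelta 1 p l = 0) (r m : ℕ) :
    IrrNode p l r m ↔ ∃ s < (p : ℕ) ^ r, m = l + ((p : ℕ) - 1) * s ∧
      ‖kummerBernoulli p l s‖ ≤ ‖((p : ℕ) : ℚ_[p])‖ ^ (r + 1) := by
  obtain ⟨h2, hl, he⟩ := bounds_of_mem_irregularPairs h
  have hmod : ∀ s j r : ℕ, s + j * (p : ℕ) ^ r ≡ s [MOD (p : ℕ) ^ r] := fun s j r => by
    simp [Nat.ModEq]
  constructor
  · intro hn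
    induction hn with
    | root =>
      refine ⟨0, by simp, by simp, ?_⟩
      simpa using (mem_irregularPairs_one_iff h2 hl he).mp h
    | child r m j _ hm hj ih =>
      obtain ⟨s, hs, rfl, -⟩ := ih
      refine ⟨s + j * (p : ℕ) ^ r, ?_, ?_, ?_⟩
      · have : (j + 1) * (p : ℕ) ^ r ≤ p * (p : ℕ) ^ r := Nat.mul_le_mul_right _ hj
        rw [add_mul, one_mul] at this
        rw [pow_succ']
        omega
      · rw [totient_prime_pow_succ]
        ring
      · rw [norm_kummerBernoulli_le_iff_of_irrDelta_eq_zero h hΔ (hmod s j r) le_rfl]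
        exact ((mem_irregularPairs_add_mul_iff h2 hl he _ _).mp hm).2
  · induction r generalizing m with
    | zero =>
      rintro ⟨s, hs, rfl, -⟩
      obtain rfl : s = 0 := by simpa using hs
      simpa using IrrNode.root
    | succ r ih =>
      rintro ⟨s, hs, rfl, hsF⟩
      have hpos : 0 < (p : ℕ) ^ r := pow_pos p.2.pos r
      have hdm := Nat.mod_add_div s ((p : ℕ) ^ r)
      have hlt := Nat.mod_lt s hpos
      have hF := (norm_kummerBernoulli_le_iff_of_irrDelta_eq_zero h hΔ
        (Nat.mod_modEq s ((p : ℕ) ^ r)) le_rfl).mpr hsF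
      have hnode := ih _ ⟨s % (p : ℕ) ^ r, hlt, rfl,
        hF.trans (Padic.norm_p_pow_le_norm_p_pow (by omega))⟩
      have := IrrNode.child r _ (s / (p : ℕ) ^ r) hnode
        ((mem_irregularPairs_add_mul_iff h2 hl he _ _).mpr
          ⟨hlt.trans_le (Nat.pow_le_pow_right p.2.pos (by omega)), hF⟩)
        (Nat.div_lt_of_lt_mul (by rwa [← pow_succ]))
      convert this using 1
      rw [totient_prime_pow_succ]
      conv_lhs => rw [← hdm]
      ring

theorem irrTreeTrivial_iff (h : (p, l) ∈ irregularPairs 1) (hΔ : irrDelta 1 p l = 0) :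
    IrrTreeTrivial p l ↔ ¬ ‖kummerBernoulli p l 0‖ ≤ ‖((p : ℕ) : ℚ_[p])‖ ^ 2 := by
  constructor
  · intro ht h0
    have h1 : ((1, l) : ℕ × ℕ) ∈ irrTree p l :=
      (irrNode_iff h hΔ 1 l).mpr ⟨0, by simpa using p.2.pos, by simp, h0⟩
    rw [ht] at h1
    simp at h1
  · intro h0
    ext ⟨r, m⟩
    constructor
    · intro hm
      obtain ⟨s, hs, rfl, hF⟩ := (irrNode_iff h hΔ r m).mp hm
      rcases r with _ | r
      · obtain rfl : s = 0 := by simpa using hs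
        simp
      · refine absurd ?_ h0
        -- Congruence modulo `p^0` is vacuous: in the singular case `F` is constant modulo `p²`.
        rw [← norm_kummerBernoulli_le_iff_of_irrDelta_eq_zero h hΔ (s := s) (r := 0)
          (by simpa using Nat.modEq_one) le_rfl]
        exact hF.trans (Padic.norm_p_pow_le_norm_p_pow (by omega))
    · rintro hm
      obtain ⟨rfl, rfl⟩ := Prod.mk.inj (Set.mem_singleton_iff.mp hm)
      exact IrrNode.root

theorem mem_irrHeights_iff (h : (p, l) ∈ irregularPairs 1) (hΔ : irrDelta 1 p l = 0) (s r : ℕ) :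
    r ∈ irrHeights p (l + ((p : ℕ) - 1) * s) ↔
      ‖kummerBernoulli p l s‖ ≤ ‖((p : ℕ) : ℚ_[p])‖ ^ (r + 1) := by
  obtain ⟨h2, hl, he⟩ := bounds_of_mem_irregularPairs h
  have hl' : (l + ((p : ℕ) - 1) * s) % ((p : ℕ) - 1) = l := by
    rw [Nat.add_mul_mod_self_left, Nat.mod_eq_of_lt hl]
  have hpos : 0 < (p : ℕ) ^ r := pow_pos p.2.pos r
  have hmod : (l + ((p : ℕ) - 1) * s) % Nat.totient ((p : ℕ) ^ (r + 1)) =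
      l + ((p : ℕ) - 1) * (s % (p : ℕ) ^ r) := by
    rw [totient_prime_pow_succ, ← Nat.mod_add_div s ((p : ℕ) ^ r), mul_add, ← add_assoc,
      ← mul_assoc, Nat.add_mul_mod_self_left, Nat.mod_add_div]
    exact Nat.mod_eq_of_lt ((add_mul_lt_mul_pow_iff hl _ _).mpr (Nat.mod_lt _ hpos))
  rw [irrHeights, Set.mem_ofPred_eq, hl', hmod]
  change IrrNode p l r _ ↔ _
  rw [irrNode_iff h hΔ, ← norm_kummerBernoulli_le_iff_of_irrDelta_eq_zero h hΔ
    (Nat.mod_modEq s ((p : ℕ) ^ r)) (by omega : r + 1 ≤ r + 2)]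
  constructor
  · rintro ⟨t, -, ht2, ht3⟩
    have : s % (p : ℕ) ^ r = t :=
      Nat.eq_of_mul_eq_mul_left (by omega : 0 < (p : ℕ) - 1) (Nat.add_left_cancel ht2)
    rwa [this]
  · intro hF
    exact ⟨_, Nat.mod_lt _ hpos, rfl, hF⟩

/-- The heights are exactly the `r` with `r + 1 ≤ v`, where `v ≥ 1` is the valuation of `F(s)`.
Nonvanishing of `F(s)` makes the set bounded, so the supremum is a genuine maximum. -/
theorem exists_isGreatest_irrHeights (h : (p, l) ∈ irregularPairs 1) (hΔ : irrDelta 1 p l = 0)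
    {s : ℕ} (hs : kummerBernoulli p l s ≠ 0) :
    IsGreatest (irrHeights p (l + ((p : ℕ) - 1) * s)) (irrHeight p (l + ((p : ℕ) - 1) * s)) ∧
      ‖kummerBernoulli p l s‖ =
        ‖((p : ℕ) : ℚ_[p])‖ ^ (1 + irrHeight p (l + ((p : ℕ) - 1) * s)) := by
  obtain ⟨h2, hl, he⟩ := bounds_of_mem_irregularPairs h
  have hF := isKummerFunction_of_bounds h2 hl
  obtain ⟨v, hv⟩ := Padic.exists_norm_eq_pow hs (hF.norm_le_one s)
  have h0 := (mem_irregularPairs_one_iff h2 hl he).mp h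
  have hv1 : 1 ≤ v := by
    have h1 := (norm_kummerBernoulli_le_iff_of_irrDelta_eq_zero h hΔ (s := s) (t := 0) (r := 0)
      (k := 1) (by simpa using Nat.modEq_one) (by omega)).mpr (by simpa using h0)
    rwa [hv, Padic.norm_p_pow_le_iff] at h1
  have hg : IsGreatest (irrHeights p (l + ((p : ℕ) - 1) * s)) (v - 1) := by
    refine ⟨?_, fun r hr => ?_⟩
    · rw [mem_irrHeights_iff h hΔ, hv, Padic.norm_p_pow_le_iff]
      omega
    · rw [mem_irrHeights_iff h hΔ, hv, Padic.norm_p_pow_le_iff] at hr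
      omega
  have heq : irrHeight p (l + ((p : ℕ) - 1) * s) = v - 1 := hg.csSup_eq
  rw [heq]
  refine ⟨hg, ?_⟩
  rw [hv]
  congr 1
  omega

theorem irrHeight_eq_zero_iff (h : (p, l) ∈ irregularPairs 1) (hΔ : irrDelta 1 p l = 0)
    {s : ℕ} (hs : kummerBernoulli p l s ≠ 0) :
    irrHeight p (l + ((p : ℕ) - 1) * s) = 0 ↔ IrrTreeTrivial p l := by
  rw [irrTreeTrivial_iff h hΔ, ← norm_kummerBernoulli_le_iff_of_irrDelta_eq_zero h hΔ (s := s)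
    (r := 0) (by simpa using Nat.modEq_one) le_rfl, (exists_isGreatest_irrHeights h hΔ hs).2,
    Padic.norm_p_pow_le_iff]
  omega

theorem norm_kummerBernoulli_eq_one (h2 : 2 ≤ l) (hl : l < (p : ℕ) - 1) (he : Even l)
    (h : (p, l) ∉ irregularPairs 1) (s : ℕ) : ‖kummerBernoulli p l s‖ = 1 := by
  have hF := isKummerFunction_of_bounds h2 hl
  refine le_antisymm (hF.norm_le_one s) (not_lt.mp fun hs => h ?_)
  rw [mem_irregularPairs_one_iff h2 hl he]
  have h1 := Padic.le_norm_p_pow_succ_of_lt (n := 0) (by rwa [pow_zero])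
  rw [zero_add, pow_one] at h1
  have := Padic.norm_sub_le_of_le h1 (hF.norm_sub_le_norm_p s 0)
  rwa [sub_sub_cancel] at this

end IrregularPairs

/-! ### The product formula over the rationals -/

section ProductFormula

theorem hasFiniteMulSupport_of_forall_eq_one {M : Type*} [One M] {f : Nat.Primes → M} (N : ℕ)
    (h : ∀ p : Nat.Primes, N < p → f p = 1) : Function.HasFiniteMulSupport f := by
  refine Set.Finite.subset (s := (fun p : Nat.Primes => (p : ℕ)) ⁻¹' Set.Iic N)
    ((Set.finite_Iic N).preimage Subtype.val_injective.injOn) fun p hp => ?_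
  by_contra hN
  exact hp (h p (not_le.mp hN))

theorem finprod_mul_mul_mul_distrib {α M : Type*} [CommMonoid M] {a b c d : α → M}
    (ha : Function.HasFiniteMulSupport a) (hb : Function.HasFiniteMulSupport b)
    (hc : Function.HasFiniteMulSupport c) (hd : Function.HasFiniteMulSupport d) :
    ∏ᶠ x, a x * b x * c x * d x = (∏ᶠ x, a x) * (∏ᶠ x, b x) * (∏ᶠ x, c x) * ∏ᶠ x, d x := by
  rw [finprod_mul_distrib (f := fun x => a x * b x * c x) ((ha.mul hb).mul hc) hd,
    finprod_mul_distrib (f := fun x => a x * b x) (ha.mul hb) hc, finprod_mul_distrib ha hb]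

theorem norm_natCast_eq_one_of_lt {p : Nat.Primes} {m : ℕ} (hm : m ≠ 0) (h : m < p) :
    ‖(m : ℚ_[(p : ℕ)])‖ = 1 :=
  Padic.norm_natCast_eq_one_iff.mpr
    ((Nat.Prime.coprime_iff_not_dvd p.2).mpr (Nat.not_dvd_of_pos_of_lt (by omega) h))

theorem hasFiniteMulSupport_norm_natCast {m : ℕ} (hm : m ≠ 0) :
    Function.HasFiniteMulSupport fun p : Nat.Primes => ‖(m : ℚ_[(p : ℕ)])‖⁻¹ :=
  hasFiniteMulSupport_of_forall_eq_one m fun p hp => by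
    rw [norm_natCast_eq_one_of_lt hm hp, inv_one]

theorem finprod_norm_natCast_inv {m : ℕ} (hm : m ≠ 0) :
    ∏ᶠ p : Nat.Primes, ‖(m : ℚ_[(p : ℕ)])‖⁻¹ = m := by
  induction m using Nat.recOnMul with
  | zero => exact absurd rfl hm
  | one => simp
  | prime q hq =>
    obtain ⟨r, rfl⟩ : ∃ r : Nat.Primes, (r : ℕ) = q := ⟨⟨q, hq⟩, rfl⟩
    rw [finprod_eq_single _ r]
    · rw [Padic.norm_p, inv_inv]
    · intro p hp
      rw [Padic.norm_natCast_eq_one_iff.mpr, inv_one]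
      exact (Nat.coprime_primes p.2 hq).mpr fun h => hp (Subtype.ext h)
  | mul a b iha ihb =>
    obtain ⟨ha, hb⟩ := mul_ne_zero_iff.mp hm
    simp only [Nat.cast_mul, norm_mul, mul_inv]
    rw [finprod_mul_distrib (hasFiniteMulSupport_norm_natCast ha)
      (hasFiniteMulSupport_norm_natCast hb), iha ha, ihb hb]

theorem norm_ratCast_inv_eq (p : Nat.Primes) (q : ℚ) :
    ‖(q : ℚ_[(p : ℕ)])‖⁻¹ =
      ‖(q.num.natAbs : ℚ_[(p : ℕ)])‖⁻¹ / ‖(q.den : ℚ_[(p : ℕ)])‖⁻¹ := by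
  conv_lhs => rw [Rat.cast_def, norm_div, inv_div, ← inv_div_inv]
  congr 2
  rw [← Int.cast_natCast, Int.natCast_natAbs]
  rcases abs_choice q.num with h | h <;> simp [h]

theorem hasFiniteMulSupport_norm_ratCast {q : ℚ} (hq : q ≠ 0) :
    Function.HasFiniteMulSupport fun p : Nat.Primes => ‖(q : ℚ_[(p : ℕ)])‖⁻¹ := by
  refine hasFiniteMulSupport_of_forall_eq_one (max q.num.natAbs q.den) fun p hp => ?_
  rw [norm_ratCast_inv_eq,
    norm_natCast_eq_one_of_lt (by simpa using hq) ((le_max_left _ _).trans_lt hp),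
    norm_natCast_eq_one_of_lt q.den_nz ((le_max_right _ _).trans_lt hp), inv_one, div_one]

theorem finprod_norm_ratCast_inv {q : ℚ} (hq : q ≠ 0) :
    ∏ᶠ p : Nat.Primes, ‖(q : ℚ_[(p : ℕ)])‖⁻¹ = |(q : ℝ)| := by
  have hn : q.num.natAbs ≠ 0 := by simpa using hq
  simp only [norm_ratCast_inv_eq]
  rw [finprod_div_distrib (hasFiniteMulSupport_norm_natCast hn)
    (hasFiniteMulSupport_norm_natCast q.den_nz), finprod_norm_natCast_inv hn,
    finprod_norm_natCast_inv q.den_nz, Rat.cast_def, abs_div, Nat.abs_cast, Nat.cast_natAbs,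
    Int.cast_abs]

end ProductFormula

/-! ### Sign, nonvanishing and denominators of Bernoulli numbers -/

section BernoulliNumbers

/-- Euler's formula for `ζ(2k)`, whose series is at least its first term `1`. -/
theorem neg_one_pow_mul_bernoulli_pos {k : ℕ} (hk : k ≠ 0) :
    0 < (-1 : ℝ) ^ (k + 1) * ((bernoulli (2 * k) : ℚ) : ℝ) := by
  have h := hasSum_zeta_nat hk
  have h1 : (1 : ℝ) ≤ (-1 : ℝ) ^ (k + 1) * (2 : ℝ) ^ (2 * k - 1) * Real.pi ^ (2 * k) *
      bernoulli (2 * k) / (2 * k).factorial := by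
    have := le_hasSum h 1 fun n _ => by positivity
    simpa using this
  have h2 : 0 < (2 : ℝ) ^ (2 * k - 1) * Real.pi ^ (2 * k) / (2 * k).factorial := by positivity
  have h3 : (-1 : ℝ) ^ (k + 1) * (2 : ℝ) ^ (2 * k - 1) * Real.pi ^ (2 * k) *
      bernoulli (2 * k) / (2 * k).factorial = (-1 : ℝ) ^ (k + 1) * ((bernoulli (2 * k) : ℚ) : ℝ) *
      ((2 : ℝ) ^ (2 * k - 1) * Real.pi ^ (2 * k) / (2 * k).factorial) := by ring
  rw [h3] at h1
  exact pos_of_mul_pos_left (zero_lt_one.trans_le h1) h2.le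

theorem bernoulli_ne_zero_of_even {n : ℕ} (hn : 2 ≤ n) (he : Even n) : bernoulli n ≠ 0 := by
  obtain ⟨k, rfl⟩ := even_iff_two_dvd.mp he
  intro h
  have := neg_one_pow_mul_bernoulli_pos (k := k) (by omega)
  simp [h] at this

theorem bernoulli_eq_neg_one_pow_mul_abs {n : ℕ} (hn : 2 ≤ n) (he : Even n) :
    ((bernoulli n : ℚ) : ℝ) = (-1 : ℝ) ^ (n / 2 - 1) * |((bernoulli n : ℚ) : ℝ)| := by
  obtain ⟨k, rfl⟩ := even_iff_two_dvd.mp he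
  obtain ⟨j, rfl⟩ : ∃ j, k = j + 1 := ⟨k - 1, by omega⟩
  have h := neg_one_pow_mul_bernoulli_pos (k := j + 1) (by omega)
  rw [Nat.mul_div_cancel_left _ two_pos, Nat.add_sub_cancel]
  rw [pow_add, pow_add] at h
  rcases neg_one_pow_eq_or ℝ j with hj | hj <;> rw [hj] at h ⊢
  · rw [abs_of_pos (by linarith), one_mul]
  · rw [abs_of_neg (by linarith)]
    ring

theorem norm_bernoulli_of_sub_one_dvd {p : Nat.Primes} {n : ℕ} (hn : 2 ≤ n) (he : Even n)
    (hp : (p : ℕ) - 1 ∣ n) : ‖((bernoulli n : ℚ) : ℚ_[(p : ℕ)])‖ = (p : ℕ) := by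
  obtain ⟨k, rfl⟩ := even_iff_two_dvd.mp he
  obtain ⟨z, hz⟩ := Bernoulli.vonStaudt_clausen k
  set S := (Finset.range (2 * k + 2)).filter fun q : ℕ => q.Prime ∧ q - 1 ∣ 2 * k with hS
  have hpS : (p : ℕ) ∈ S := by
    have := Nat.le_of_dvd (by omega) hp
    exact Finset.mem_filter.mpr ⟨Finset.mem_range.mpr (by omega), p.2, hp⟩
  rw [← Finset.add_sum_erase _ _ hpS] at hz
  have hB : ((bernoulli (2 * k) : ℚ) : ℚ_[(p : ℕ)]) =
      ((z : ℚ_[(p : ℕ)]) - ∑ q ∈ S.erase p, ((q : ℕ) : ℚ_[(p : ℕ)])⁻¹) -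
        ((p : ℕ) : ℚ_[(p : ℕ)])⁻¹ := by
    have := congrArg (fun x : ℚ => (x : ℚ_[(p : ℕ)])) hz
    push_cast at this
    simp only [one_div] at this
    linear_combination -this
  have h1 : ‖(z : ℚ_[(p : ℕ)]) - ∑ q ∈ S.erase p, ((q : ℕ) : ℚ_[(p : ℕ)])⁻¹‖ ≤ 1 := by
    refine Padic.norm_sub_le_of_le (Padic.norm_int_le_one z)
      (IsUltrametricDist.norm_sum_le_of_forall_le_of_nonneg zero_le_one fun q hq => ?_)
    obtain ⟨hqp, hqS⟩ := Finset.mem_erase.mp hq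
    rw [norm_inv, Padic.norm_natCast_eq_one_iff.mpr, inv_one]
    exact (Nat.coprime_primes p.2 (Finset.mem_filter.mp hqS).2.1).mpr hqp.symm
  have h2 : ‖-((p : ℕ) : ℚ_[(p : ℕ)])⁻¹‖ = (p : ℕ) := by
    rw [norm_neg, norm_inv, Padic.norm_p, inv_inv]
  have h3 : (1 : ℝ) < (p : ℕ) := by exact_mod_cast p.2.one_lt
  -- Only the term `1/p` of von Staudt–Clausen is not `p`-integral, so it dominates.
  rw [hB, sub_eq_add_neg, Padic.add_eq_max_of_ne (by rw [h2]; linarith), h2,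
    max_eq_right (by linarith)]

end BernoulliNumbers

/-! ### Local factors and their assembly -/

section Factors

variable {p : Nat.Primes} {n : ℕ}

theorem bounds_mod_of_not_dvd (he : Even n) (hp : ¬ (p : ℕ) - 1 ∣ n) :
    2 ≤ n % ((p : ℕ) - 1) ∧ n % ((p : ℕ) - 1) < (p : ℕ) - 1 ∧ Even (n % ((p : ℕ) - 1)) := by
  have hp2 : (p : ℕ) ≠ 2 := fun h => hp (by simp [h])
  have hpe : Even ((p : ℕ) - 1) := p.2.even_sub_one hp2
  have h0 : n % ((p : ℕ) - 1) ≠ 0 := fun h => hp (Nat.dvd_of_mod_eq_zero h)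
  have hev : Even (n % ((p : ℕ) - 1)) := by
    rw [← Nat.mod_add_div n ((p : ℕ) - 1), Nat.even_add] at he
    exact he.mpr (hpe.mul_right _)
  have hlt : n % ((p : ℕ) - 1) < (p : ℕ) - 1 := Nat.mod_lt _ (by have := p.2.two_le; omega)
  obtain ⟨k, hk⟩ := hev
  exact ⟨by omega, hlt, ⟨k, hk⟩⟩

theorem eq_mod_of_modEq {l : ℕ} (h : (p, l) ∈ irregularPairs 1) (hn : n ≡ l [MOD (p : ℕ) - 1]) :
    l = n % ((p : ℕ) - 1) := by
  have := (bounds_of_mem_irregularPairs h).2.1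
  exact ((Nat.mod_eq_of_lt this).symm.trans hn.symm)

theorem exists_eq_add_mul {l : ℕ} (h : (p, l) ∈ irregularPairs 1)
    (hn : n ≡ l [MOD (p : ℕ) - 1]) : ∃ s, n = l + ((p : ℕ) - 1) * s :=
  ⟨n / ((p : ℕ) - 1), by rw [eq_mod_of_modEq h hn, Nat.mod_add_div]⟩

theorem not_dvd_of_modEq {l : ℕ} (h : (p, l) ∈ irregularPairs 1)
    (hn : n ≡ l [MOD (p : ℕ) - 1]) : ¬ (p : ℕ) - 1 ∣ n := by
  obtain ⟨h2, hl, -⟩ := bounds_of_mem_irregularPairs h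
  exact fun hd => not_dvd_of_bounds h2 hl ((hn.dvd_iff dvd_rfl).mp hd)

theorem kummerBernoulli_ne_zero {l s : ℕ} (h : (p, l) ∈ irregularPairs 1) :
    kummerBernoulli p l s ≠ 0 := by
  obtain ⟨h2, hl, he⟩ := bounds_of_mem_irregularPairs h
  have hB := bernoulli_ne_zero_of_even (n := l + ((p : ℕ) - 1) * s) (by omega)
    (he.add ((even_sub_one_of_bounds h2 hl).mul_right _))
  have hn0 : ((l + ((p : ℕ) - 1) * s : ℕ) : ℚ_[(p : ℕ)]) ≠ 0 := by
    exact_mod_cast (by omega : l + ((p : ℕ) - 1) * s ≠ 0)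
  rw [← norm_ne_zero_iff, norm_kummerBernoulli h2, norm_ne_zero_iff]
  exact div_ne_zero (by exact_mod_cast hB) hn0

/-- The factor of a nonsingular pair in the structural formula for `B_n`. -/
noncomputable def nonsingularFactor (n : ℕ) (x : Nat.Primes × ℕ) : ℝ :=
  ‖((x.1 : ℕ) : ℚ_[(x.1 : ℕ)]) *
    ((irrChi x.1 x.2 : ℚ_[(x.1 : ℕ)]) -
      ((n : ℚ_[(x.1 : ℕ)]) - (x.2 : ℚ_[(x.1 : ℕ)])) / (((x.1 : ℕ) : ℚ_[(x.1 : ℕ)]) - 1))‖⁻¹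

theorem nonsingularFactor_eq {l s : ℕ} (h : (p, l) ∈ irregularPairs 1)
    (hΔ : irrDelta 1 p l ≠ 0) (hn : n = l + ((p : ℕ) - 1) * s) :
    nonsingularFactor n (p, l) = ‖kummerBernoulli p l s‖⁻¹ := by
  have hp1 : ((p : ℕ) : ℚ_[(p : ℕ)]) - 1 ≠ 0 := by
    rw [sub_ne_zero]
    exact_mod_cast p.2.one_lt.ne'
  have hs : ((n : ℚ_[(p : ℕ)]) - (l : ℚ_[(p : ℕ)])) / (((p : ℕ) : ℚ_[(p : ℕ)]) - 1) = s := by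
    rw [hn, Nat.cast_add, Nat.cast_mul, Nat.cast_sub p.2.one_le, Nat.cast_one,
      add_sub_cancel_left, mul_div_cancel_left₀ _ hp1]
  rw [norm_kummerBernoulli_eq_of_irrDelta_ne_zero h hΔ, nonsingularFactor]
  simp only [hs]

theorem singularFactor_eq {l s : ℕ} (h : (p, l) ∈ irregularPairs 1)
    (hΔ : irrDelta 1 p l = 0) (hn : n = l + ((p : ℕ) - 1) * s) :
    ((p : ℕ) : ℝ) ^ (1 + irrHeight p n) = ‖kummerBernoulli p l s‖⁻¹ := by
  rw [hn, (exists_isGreatest_irrHeights h hΔ (kummerBernoulli_ne_zero h)).2, Padic.norm_p, inv_pow,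
    inv_inv]

/-- Each prime carries at most one admissible `l`, so a product over pairs becomes a product over
primes, to be merged with the other local factors. -/
theorem finprod_mem_pairs {S : Set (Nat.Primes × ℕ)}
    (hS : ∀ x ∈ S, x.2 = n % ((x.1 : ℕ) - 1)) (g : Nat.Primes × ℕ → ℝ) :
    ∏ᶠ (x : Nat.Primes × ℕ) (_ : x ∈ S), g x =
      ∏ᶠ (p : Nat.Primes) (_ : (p, n % ((p : ℕ) - 1)) ∈ S), g (p, n % ((p : ℕ) - 1)) := by
  have hx : ∀ x ∈ S, (x.1, n % ((x.1 : ℕ) - 1)) = x := fun x hx => by rw [← hS x hx]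
  refine finprod_mem_eq_of_bijOn (t := {p : Nat.Primes | (p, n % ((p : ℕ) - 1)) ∈ S}) Prod.fst
    ⟨fun x hxS => ?_, fun x hxS y hyS hxy => ?_, fun p hp => ⟨_, hp, rfl⟩⟩ fun x hxS => ?_
  · change _ ∈ S
    rwa [hx x hxS]
  · rw [← hx x hxS, ← hx y hyS, hxy]
  · rw [hx x hxS]

/-- An irregular pair with `n ≡ l` forces `|B_n / n|_p < 1`, which a nonzero rational allows for
only finitely many `p`. -/
theorem finite_pairs {S : Set (Nat.Primes × ℕ)} (hn : 2 ≤ n) (he : Even n)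
    (hS : ∀ x ∈ S, x ∈ irregularPairs 1 ∧ n ≡ x.2 [MOD (x.1 : ℕ) - 1]) : S.Finite := by
  have hq : bernoulli n / (n : ℚ) ≠ 0 :=
    div_ne_zero (bernoulli_ne_zero_of_even hn he) (by exact_mod_cast (by omega : n ≠ 0))
  have hfin : (Function.mulSupport fun p : Nat.Primes =>
      ‖((bernoulli n / (n : ℚ) : ℚ) : ℚ_[(p : ℕ)])‖⁻¹).Finite := hasFiniteMulSupport_norm_ratCast hq
  refine (hfin.image fun p : Nat.Primes => (p, n % ((p : ℕ) - 1))).subset fun x hx => ?_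
  obtain ⟨p, l⟩ := x
  obtain ⟨h, hmod⟩ := hS _ hx
  obtain ⟨h2, hl, hle⟩ := bounds_of_mem_irregularPairs h
  refine ⟨p, ?_, Prod.ext rfl (eq_mod_of_modEq h hmod).symm⟩
  obtain ⟨s, rfl⟩ := exists_eq_add_mul h hmod
  have hF := isKummerFunction_of_bounds h2 hl
  have h1 := Padic.norm_add_le_of_le (hF.norm_sub_le_norm_p s 0)
    ((mem_irregularPairs_one_iff h2 hl hle).mp h)
  rw [sub_add_cancel, norm_kummerBernoulli h2] at h1
  have h3 := h1.trans_lt Padic.norm_p_lt_one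
  intro h4
  simp only [inv_eq_one, Rat.cast_div, Rat.cast_natCast] at h4
  exact h3.ne h4

theorem mem_irregularPairs_of_mem_nonsingularPairs {x : Nat.Primes × ℕ}
    (hx : x ∈ nonsingularPairs n) : x ∈ irregularPairs 1 ∧ n ≡ x.2 [MOD (x.1 : ℕ) - 1] :=
  ⟨hx.1, hx.2.2⟩

theorem mem_irregularPairs_of_mem_singularPairs {x : Nat.Primes × ℕ}
    (hx : x ∈ singularPairs n) : x ∈ irregularPairs 1 ∧ n ≡ x.2 [MOD (x.1 : ℕ) - 1] :=
  ⟨hx.1, hx.2.2⟩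

/-- At each prime, apart from `|n|_p⁻¹` when `p - 1 ∤ n`, at most one factor is nontrivial,
according to whether `p - 1 ∣ n` or `(p, l)` is nonsingular, singular or regular. -/
theorem norm_bernoulli_inv_eq (hn : 2 ≤ n) (he : Even n) (p : Nat.Primes) :
    ‖((bernoulli n : ℚ) : ℚ_[(p : ℕ)])‖⁻¹ =
      (∏ᶠ (_ : ¬ ((p : ℕ) - 1 ∣ n)), ‖(n : ℚ_[(p : ℕ)])‖⁻¹) *
      (∏ᶠ (_ : (p, n % ((p : ℕ) - 1)) ∈ nonsingularPairs n),
        nonsingularFactor n (p, n % ((p : ℕ) - 1))) *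
      (∏ᶠ (_ : (p, n % ((p : ℕ) - 1)) ∈ singularPairs n),
        ((p : ℕ) : ℝ) ^ (1 + irrHeight p n)) *
      (∏ᶠ (_ : (p : ℕ) - 1 ∣ n), ((p : ℕ) : ℝ)⁻¹) := by
  classical
  simp only [finprod_eq_if]
  by_cases hp : (p : ℕ) - 1 ∣ n
  · have h1 : (p, n % ((p : ℕ) - 1)) ∉ nonsingularPairs n := fun h =>
      not_dvd_of_modEq h.1 h.2.2 hp
    have h2 : (p, n % ((p : ℕ) - 1)) ∉ singularPairs n := fun h =>
      not_dvd_of_modEq h.1 h.2.2 hp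
    simp [hp, h1, h2, norm_bernoulli_of_sub_one_dvd hn he hp]
  · obtain ⟨h2, hl, hle⟩ := bounds_mod_of_not_dvd he hp
    have hmod : n ≡ n % ((p : ℕ) - 1) [MOD (p : ℕ) - 1] := (Nat.mod_modEq _ _).symm
    have hdm : n = n % ((p : ℕ) - 1) + ((p : ℕ) - 1) * (n / ((p : ℕ) - 1)) :=
      (Nat.mod_add_div _ _).symm
    set l := n % ((p : ℕ) - 1) with hl'
    set s := n / ((p : ℕ) - 1)
    have hn0 : (n : ℚ_[(p : ℕ)]) ≠ 0 := by exact_mod_cast (by omega : n ≠ 0)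
    have hB : ‖((bernoulli n : ℚ) : ℚ_[(p : ℕ)])‖⁻¹ =
        ‖(n : ℚ_[(p : ℕ)])‖⁻¹ * ‖kummerBernoulli p l s‖⁻¹ := by
      rw [norm_kummerBernoulli h2, ← hdm, ← mul_inv, ← norm_mul, mul_div_cancel₀ _ hn0]
    rw [hB, if_pos hp, if_neg hp, mul_one, mul_assoc]
    congr 1
    by_cases hirr : (p, l) ∈ irregularPairs 1
    · by_cases hΔ : irrDelta 1 p l = 0
      · rw [if_neg fun h => h.2.1 hΔ, if_pos ⟨hirr, hΔ, hmod⟩, one_mul,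
          singularFactor_eq hirr hΔ hdm]
      · rw [if_pos ⟨hirr, hΔ, hmod⟩, if_neg fun h => hΔ h.2.1, mul_one,
          nonsingularFactor_eq hirr hΔ hdm]
    · rw [if_neg fun h => hirr h.1, if_neg fun h => hirr h.1, mul_one,
        norm_kummerBernoulli_eq_one h2 hl hle hirr, inv_one]

theorem abs_bernoulli_eq (hn : 2 ≤ n) (he : Even n) :
    |((bernoulli n : ℚ) : ℝ)| =
      (∏ᶠ (p : Nat.Primes) (_ : ¬ ((p : ℕ) - 1 ∣ n)), ‖(n : ℚ_[(p : ℕ)])‖⁻¹) *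
      (∏ᶠ (x : Nat.Primes × ℕ) (_ : x ∈ nonsingularPairs n), nonsingularFactor n x) *
      (∏ᶠ (x : Nat.Primes × ℕ) (_ : x ∈ singularPairs n),
        ((x.1 : ℕ) : ℝ) ^ (1 + irrHeight x.1 n)) *
      (∏ᶠ (p : Nat.Primes) (_ : (p : ℕ) - 1 ∣ n), ((p : ℕ) : ℝ)⁻¹) := by
  have hmod : ∀ x : Nat.Primes × ℕ, x ∈ irregularPairs 1 ∧ n ≡ x.2 [MOD (x.1 : ℕ) - 1] →
      x.2 = n % ((x.1 : ℕ) - 1) := fun x hx => eq_mod_of_modEq hx.1 hx.2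
  have hfin : ∀ (S : Set (Nat.Primes × ℕ)) (g : Nat.Primes → ℝ), S.Finite →
      Function.HasFiniteMulSupport fun p : Nat.Primes =>
        ∏ᶠ (_ : (p, n % ((p : ℕ) - 1)) ∈ S), g p := fun S g hS => by
    refine (hS.image Prod.fst).subset fun p hp => ⟨(p, n % ((p : ℕ) - 1)), ?_, rfl⟩
    by_contra hpS
    exact hp (by simp [hpS])
  have f1 : Function.HasFiniteMulSupport fun p : Nat.Primes =>
      ∏ᶠ (_ : ¬ ((p : ℕ) - 1 ∣ n)), ‖(n : ℚ_[(p : ℕ)])‖⁻¹ :=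
    hasFiniteMulSupport_of_forall_eq_one n fun p hp => by
      rw [norm_natCast_eq_one_of_lt (by omega) hp, inv_one, finprod_one]
  have f2 := hfin (nonsingularPairs n) (fun p => nonsingularFactor n (p, n % ((p : ℕ) - 1)))
    (finite_pairs hn he fun x => mem_irregularPairs_of_mem_nonsingularPairs)
  have f3 := hfin (singularPairs n) (fun p => ((p : ℕ) : ℝ) ^ (1 + irrHeight p n))
    (finite_pairs hn he fun x => mem_irregularPairs_of_mem_singularPairs)
  have f4 : Function.HasFiniteMulSupport fun p : Nat.Primes =>
      ∏ᶠ (_ : (p : ℕ) - 1 ∣ n), ((p : ℕ) : ℝ)⁻¹ :=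
    hasFiniteMulSupport_of_forall_eq_one (n + 1) fun p hp => by
      have : ¬ (p : ℕ) - 1 ∣ n := Nat.not_dvd_of_pos_of_lt (by omega) (by omega)
      simp [this]
  rw [finprod_mem_pairs (n := n) fun x hx => hmod x (mem_irregularPairs_of_mem_nonsingularPairs hx),
    finprod_mem_pairs (n := n) (fun x hx => hmod x (mem_irregularPairs_of_mem_singularPairs hx))
      (fun x => ((x.1 : ℕ) : ℝ) ^ (1 + irrHeight x.1 n)),
    ← finprod_norm_ratCast_inv (bernoulli_ne_zero_of_even hn he)]
  exact (finprod_congr (norm_bernoulli_inv_eq hn he)).trans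
    (finprod_mul_mul_mul_distrib f1 f2 f3 f4)

end Factors

theorem mainTheorem1 (n : ℕ) (hn : 2 ≤ n) (hn2 : Even n) :
    -- the index sets are finite, and the quantities in the formula are well defined
    (nonsingularPairs n).Finite ∧ (singularPairs n).Finite ∧
    (∀ x ∈ nonsingularPairs n, ∃! s : ℕ → ℕ, IsIrrDigits x.1 x.2 s) ∧
    (∀ x ∈ singularPairs n, IsGreatest (irrHeights x.1 n) (irrHeight x.1 n)) ∧
    -- the structural formula
    ((bernoulli n : ℚ) : ℝ) =
      (-1 : ℝ) ^ (n / 2 - 1)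
        * (∏ᶠ (p : Nat.Primes) (_ : ¬ ((p : ℕ) - 1 ∣ n)), ‖(n : ℚ_[(p : ℕ)])‖⁻¹)
        * (∏ᶠ (x : Nat.Primes × ℕ) (_ : x ∈ nonsingularPairs n),
            ‖((x.1 : ℕ) : ℚ_[(x.1 : ℕ)]) *
              ((irrChi x.1 x.2 : ℚ_[(x.1 : ℕ)]) -
                ((n : ℚ_[(x.1 : ℕ)]) - (x.2 : ℚ_[(x.1 : ℕ)])) /
                  (((x.1 : ℕ) : ℚ_[(x.1 : ℕ)]) - 1))‖⁻¹)
        * (∏ᶠ (x : Nat.Primes × ℕ) (_ : x ∈ singularPairs n),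
            ((x.1 : ℕ) : ℝ) ^ (1 + irrHeight x.1 n))
        * (∏ᶠ (p : Nat.Primes) (_ : (p : ℕ) - 1 ∣ n), ((p : ℕ) : ℝ)⁻¹) ∧
    -- the height vanishes exactly for the trivial tree, and is at least one otherwise
    (∀ x ∈ singularPairs n,
      (irrHeight x.1 n = 0 ↔ IrrTreeTrivial x.1 x.2) ∧
      (¬ IrrTreeTrivial x.1 x.2 → 1 ≤ irrHeight x.1 n)) := by
  refine ⟨finite_pairs hn hn2 fun x => mem_irregularPairs_of_mem_nonsingularPairs,
    finite_pairs hn hn2 fun x => mem_irregularPairs_of_mem_singularPairs,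
    fun x hx => existsUnique_isIrrDigits hx.1 hx.2.1, ?_, ?_, ?_⟩
  · rintro ⟨p, l⟩ ⟨h, hΔ, hmod⟩
    obtain ⟨s, rfl⟩ := exists_eq_add_mul h hmod
    exact (exists_isGreatest_irrHeights h hΔ (kummerBernoulli_ne_zero h)).1
  · rw [bernoulli_eq_neg_one_pow_mul_abs hn hn2, abs_bernoulli_eq hn hn2]
    simp only [mul_assoc]
    rfl
  · rintro ⟨p, l⟩ ⟨h, hΔ, hmod⟩
    obtain ⟨s, rfl⟩ := exists_eq_add_mul h hmod
    have h1 := irrHeight_eq_zero_iff h hΔ (s := s) (kummerBernoulli_ne_zero h)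
    exact ⟨h1, fun h2 => Nat.one_le_iff_ne_zero.mpr fun h3 => h2 (h1.mp h3)⟩
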